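/- Let $d\ge 1$, let $U\subset\mathbb R^d$ be open and bounded, let $\mu_1,\dots,\mu_N\ge 0$, $b_l\in W^{1,\infty}(U)$, $\hat v\in C^1(U;\mathbb R^d)$, and for $y\in\Gamma:=[-1,1]^N$ put $$F(x,y)=x+\sum_{l=1}^N\sqrt{\mu_l}\,b_l(x)\,y_l\,\hat v(x),\qquad \partial F(x,y)=I+\sum_{l=1}^N\sqrt{\mu_l}\,B_l(x)\,y_l,\qquad B_l=b_l\,\partial\hat v+\hat v\,(\nabla b_l)^T ,$$ where each image $F(U,y)$, $y\in\Gamma$, is bounded. Both formulas are used for $z\in\mathbb C^N$ as well. Suppose that $a\circ F$ is a function of $x\in U$ only with $0<a_{min}\le a\circ F\le a_{max}<\infty$ a.e., that $f:\mathbb R^d\to\mathbb R$ extends analytically to $\mathbb C^d$ (so that $(f\circ F)(\cdot,z)$ makes sense for $z\in\mathbb C^N$), that $\hat{\bf w}\in H^1(U)$ is a real-valued lifting, independent of $y$, of the Dirichlet datum, and that for some $0<\tilde\delta<1$ $$\sum_{l=1}^N\|B_l(x)\|_2\sqrt{\mu_l}\le 1-\tilde\delta\quad\text{for a.e. }x\in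 U .$$ For $y\in\Gamma$ let $(\tilde u\circ F)(\cdot,y)\in H^1_0(U)$ denote the solution of $$\int_U (a\circ F)\,\nabla(\tilde u\circ F)^T C^{-1}\nabla v\,|\partial F|=\int_U (f\circ F)\,v\,|\partial F|-\int_U (a\circ F)\,\nabla\hat{\bf w}^TC^{-1}\nabla v\,|\partial F|\quad\forall v\in H^1_0(U),\qquad C=\partial F^T\partial F .$$ Let $$0<\beta<\min\Big\{\frac{\tilde\delta\log\gamma}{d+\log\gamma},\ \sqrt{1+\tilde\delta^2/2}-1\Big\},\quad \gamma=\frac{2\tilde\delta^d+(2-\tilde\delta)^d}{\tilde\delta^d+(2-\tilde\delta)^d},\quad \alpha=2-\exp\Big(\frac{d\beta}{\tilde\delta-\beta}\Big),$$ $$\Theta_\beta=\Big\{y+w:\ y\in[-1,1]^N,\ w\in\mathbb C^N,\ \sum_{l=1}^N\sup_{x\in U}\|B_l(x)\|_2\sqrt{\mu_l}\,|w_l|\le\beta\Big\}$$ (essential supremum), and $G(z)=(a\circ F)\det(\partial F(z))\,\partial F(z)^{-1}\partial F(z)^{-T}$. Let $C_P(U)$ be the Poincaré constant of $U$, that is,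 the least $c\ge0$ with $\|v\|_{L^2(U)}\le c\,\|\nabla v\|_{L^2(U)}$ for all $v\in H^1_0(U)$. Define $$B=\frac{\tilde\delta^{d+1}\alpha(\tilde\delta-2\beta)-2\beta(2+\beta-\tilde\delta)(1-\alpha)(2-\tilde\delta)^d}{a_{max}(2-\tilde\delta)^{2d}(2-\alpha)^2},$$ $$D=\frac{(2-\tilde\delta)^d(2-\alpha)(2-\tilde\delta+\beta)^2+2(1-\tilde\delta)^d(2-\alpha)\beta(2+\beta-\tilde\delta)}{a_{min}\tilde\delta^{2d}\alpha^2},$$ $$C=\frac{(2-\tilde\delta)^d(2-\alpha)\,2\beta(2+\beta-\tilde\delta)+(2-\tilde\delta)^d(1-\alpha)\big((2-\tilde\delta+\beta)^2+\beta^2\big)}{a_{min}\tilde\delta^{2d}\alpha^2},\qquad \varepsilon=\frac{1}{\big(1+(C/B)^2\big)D}$$ (the number $C$ here is not the matrix $C=\partial F^T\partial F$ above). Then: 1. $\varepsilon>0$, and for every $z\in\Theta_\beta$, $\lambda_{min}(\mathrm{Re}\,G(z))\ge\varepsilon$ a.e. in $U$. 2. For every $y\in\Gamma$ the solution $(\tilde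 u\circ F)(\cdot,y)$ exists and is unique, and $y\mapsto(\tilde u\circ F)(\cdot,y)$ extends to a map $z\mapsto(\tilde u\circ F)(\cdot,z)\in H^1_0(U;\mathbb C)$ that is holomorphic on a neighbourhood of $\Theta_\beta$ and whose value at each $z\in\Theta_\beta$ is the unique $\Psi\in H^1_0(U;\mathbb C)$ with $$\int_U\nabla\Psi^TG(z)\nabla v=\int_U (f\circ F)(\cdot,z)\det(\partial F(z))\,v-\int_U\nabla\hat{\bf w}^TG(z)\nabla v\qquad\forall v\in H^1_0(U;\mathbb C).$$ 3. For every $z\in\Theta_\beta$, $(f\circ F)(\cdot,z)\in L^2(U)$ and $$\|\nabla(\tilde u\circ F)(\cdot,z)\|_{L^2(U)}\le\frac{E}{\varepsilon},\qquad E=(2-\alpha)\Big(\frac{\|\nabla\hat{\bf w}\|_{L^2(U)}}{a_{max}^{-1}(2-\tilde\delta)^{-d}\tilde\delta^2}+C_P(U)\,\|(f\circ F)(\cdot,z)\|_{L^2(U)}\Big).$$ -/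

import Mathlib

open MeasureTheory Filter Topology
open scoped Matrix ContDiff ENNReal

noncomputable section

/-- Physical space `ℝ^d` with the Euclidean norm. -/
abbrev Sp (d : ℕ) := EuclideanSpace ℝ (Fin d)

/-- Lebesgue measure on `U`. -/
abbrev muOn {d : ℕ} (U : Set (Sp d)) : Measure (Sp d) := volume.restrict U

/-! ### Sobolev spaces -/

/-- `φ ∈ C_c^∞(U; 𝕜)`. -/
structure IsTest {d : ℕ} (𝕜 : Type) [RCLike 𝕜] (U : Set (Sp d)) (φ : Sp d → 𝕜) : Prop where
  smooth : ContDiff ℝ ∞ φ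
  compact : HasCompactSupport φ
  support : tsupport φ ⊆ U

/-- The partial derivative `∂_i φ`. -/
def partialD {d : ℕ} {𝕜 : Type} [RCLike 𝕜] (φ : Sp d → 𝕜) (i : Fin d) (x : Sp d) : 𝕜 :=
  fderiv ℝ φ x (EuclideanSpace.single i 1)

/-- The (classical) gradient of a `𝕜`-valued function. -/
def grad {d : ℕ} {𝕜 : Type} [RCLike 𝕜] (φ : Sp d → 𝕜) (x : Sp d) : EuclideanSpace 𝕜 (Fin d) :=
  WithLp.toLp 2 fun i => partialD φ i x

/-- `g` is the weak gradient of the real function `u` on `U`. -/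
def HasWeakGradient {d : ℕ} (U : Set (Sp d)) (u : Sp d → ℝ) (g : Sp d → Sp d) : Prop :=
  ∀ φ : Sp d → ℝ, IsTest ℝ U φ → ∀ i : Fin d,
    ∫ x in U, u x * partialD φ i x = - ∫ x in U, g x i * φ x

/-- `u ∈ W^{1,p}(U)` (real valued), with weak gradient `g`. -/
structure MemW1 {d : ℕ} (p : ℝ≥0∞) (U : Set (Sp d)) (u : Sp d → ℝ) (g : Sp d → Sp d) : Prop where
  memLp : MemLp u p (muOn U)
  memLp_grad : MemLp g p (muOn U)
  weakGradient : HasWeakGradient U u g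

/-- The Hilbert space `L²(U; 𝕜) × L²(U; 𝕜^d)` in which a function of `H¹(U; 𝕜)` is recorded as the
pair of itself and its gradient; its norm restricts to the `H¹` norm. -/
abbrev L2Pair {d : ℕ} (𝕜 : Type) [RCLike 𝕜] (U : Set (Sp d)) : Type :=
  WithLp 2 (Lp 𝕜 2 (muOn U) × Lp (EuclideanSpace 𝕜 (Fin d)) 2 (muOn U))

theorem IsTest.grad_add {d : ℕ} {𝕜 : Type} [RCLike 𝕜] {U : Set (Sp d)} {φ ψ : Sp d → 𝕜}
    (hφ : IsTest 𝕜 U φ) (hψ : IsTest 𝕜 U ψ) (x : Sp d) :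
    grad (φ + ψ) x = grad φ x + grad ψ x := by
  have h1 := (hφ.smooth.differentiable (by simp)) x
  have h2 := (hψ.smooth.differentiable (by simp)) x
  ext i
  simp [grad, partialD, fderiv_add h1 h2]

theorem IsTest.grad_smul {d : ℕ} {𝕜 : Type} [RCLike 𝕜] {U : Set (Sp d)} {φ : Sp d → 𝕜}
    (hφ : IsTest 𝕜 U φ) (c : 𝕜) (x : Sp d) :
    grad (c • φ) x = c • grad φ x := by
  have h1 := (hφ.smooth.differentiable (by simp)) x
  ext i
  simp [grad, partialD, fderiv_const_smul h1 c]

/-- The pairs `(φ, ∇φ)` with `φ ∈ C_c^∞(U; 𝕜)`. -/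
def testPairs {d : ℕ} (𝕜 : Type) [RCLike 𝕜] (U : Set (Sp d)) : Submodule 𝕜 (L2Pair 𝕜 U) where
  carrier := {p | ∃ φ : Sp d → 𝕜, IsTest 𝕜 U φ ∧ p.fst =ᵐ[muOn U] φ ∧ p.snd =ᵐ[muOn U] grad φ}
  zero_mem' := by
    refine ⟨0, ⟨contDiff_const, HasCompactSupport.zero, by simp⟩, Lp.coeFn_zero _ _ _, ?_⟩
    refine (Lp.coeFn_zero _ _ _).trans (Eventually.of_forall fun x => ?_)
    ext i
    simp [grad, partialD]
  add_mem' := by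
    rintro p q ⟨φ, hφ, hp1, hp2⟩ ⟨ψ, hψ, hq1, hq2⟩
    refine ⟨φ + ψ, ⟨hφ.smooth.add hψ.smooth, hφ.compact.add hψ.compact,
      (tsupport_add φ ψ).trans (Set.union_subset hφ.support hψ.support)⟩,
      (Lp.coeFn_add _ _).trans (hp1.add hq1), (Lp.coeFn_add _ _).trans ?_⟩
    filter_upwards [hp2, hq2] with x h1 h2
    rw [hφ.grad_add hψ, ← h1, ← h2]
    rfl
  smul_mem' := by
    rintro c p ⟨φ, hφ, hp1, hp2⟩
    refine ⟨c • φ, ⟨hφ.smooth.const_smul c, hφ.compact.smul_left,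
      (closure_mono (Function.support_const_smul_subset c φ)).trans hφ.support⟩,
      (Lp.coeFn_smul _ _).trans (hp1.const_smul c), (Lp.coeFn_smul _ _).trans ?_⟩
    filter_upwards [hp2] with x h1
    rw [hφ.grad_smul, ← h1]
    rfl

/-- `H¹₀(U; 𝕜)`: the closure of `C_c^∞(U; 𝕜)` in the `H¹` norm. -/
def H10 {d : ℕ} (𝕜 : Type) [RCLike 𝕜] (U : Set (Sp d)) : Submodule 𝕜 (L2Pair 𝕜 U) :=
  (testPairs 𝕜 U).topologicalClosure

/-- The function underlying an element of `H¹₀`. -/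
def h10Val {d : ℕ} {𝕜 : Type} [RCLike 𝕜] {U : Set (Sp d)} (u : H10 𝕜 U) : Lp 𝕜 2 (muOn U) :=
  (u : L2Pair 𝕜 U).fst

/-- The gradient of an element of `H¹₀`. -/
def h10Grad {d : ℕ} {𝕜 : Type} [RCLike 𝕜] {U : Set (Sp d)} (u : H10 𝕜 U) :
    Lp (EuclideanSpace 𝕜 (Fin d)) 2 (muOn U) :=
  (u : L2Pair 𝕜 U).snd

/-- The Poincaré constant of `U`: the best `C` with `‖v‖_{L²} ≤ C ‖∇v‖_{L²}` on `H¹₀(U)`. Complex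
valued functions are used, which gives the same constant as real valued ones (treat real and
imaginary parts separately). -/
def poincareConst {d : ℕ} (U : Set (Sp d)) : ℝ :=
  sInf {C : ℝ | 0 ≤ C ∧ ∀ v : H10 ℂ U, ‖h10Val v‖ ≤ C * ‖h10Grad v‖}

/-! ### Weak formulation of the diffusion problem on the reference domain -/

/-- `u ∈ H¹₀(U; 𝕜)` satisfies `∫ ∇uᵀ A ∇v = ∫ h v - ∫ gwᵀ A ∇v` for all `v ∈ H¹₀(U; 𝕜)`. The forms
are bilinear: nothing is conjugated. -/
def IsWeakSolution {d : ℕ} {𝕜 : Type} [RCLike 𝕜] (U : Set (Sp d))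
    (A : Sp d → Matrix (Fin d) (Fin d) 𝕜) (h : Sp d → 𝕜) (gw : Sp d → Fin d → 𝕜)
    (u : H10 𝕜 U) : Prop :=
  ∀ v : H10 𝕜 U,
    ∫ x in U, (h10Grad u x).ofLp ⬝ᵥ (A x *ᵥ (h10Grad v x).ofLp) =
      (∫ x in U, h x * h10Val v x) - ∫ x in U, gw x ⬝ᵥ (A x *ᵥ (h10Grad v x).ofLp)

/-! ### The domain mapping -/

/-- The Jacobian matrix of a vector field. -/
def jac {d : ℕ} (v : Sp d → Sp d) (x : Sp d) : Matrix (Fin d) (Fin d) ℝ :=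
  Matrix.of fun i j => fderiv ℝ v x (EuclideanSpace.single j 1) i

/-- The spectral norm `‖M‖₂` of a real matrix. -/
def specNorm {d : ℕ} (M : Matrix (Fin d) (Fin d) ℝ) : ℝ :=
  ‖Matrix.toEuclideanCLM (n := Fin d) (𝕜 := ℝ) M‖

/-- The data of the mapping `F(x,y) = x + (∑ l, √μ_l b_l(x) y_l) v̂(x)`: the numbers `μ_l`, the
functions `b_l`, their weak gradients `gradb l`, and the vector field `v̂`. -/
structure MapData (d N : ℕ) where
  mu : Fin N → ℝ
  b : Fin N → Sp d → ℝ
  gradb : Fin N → Sp d → Sp d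
  vhat : Sp d → Sp d

namespace MapData

variable {d N : ℕ} (P : MapData d N)

/-- The mapping `F(·, y)` for a real parameter `y`. -/
def F (y : Fin N → ℝ) (x : Sp d) : Sp d :=
  x + (∑ l, √(P.mu l) * P.b l x * y l) • P.vhat x

/-- The mapping `F(·, z)` for a complex parameter `z`. -/
def FC (z : Fin N → ℂ) (x : Sp d) : Fin d → ℂ := fun i =>
  (x i : ℂ) + (∑ l, ((√(P.mu l) * P.b l x : ℝ) : ℂ) * z l) * (P.vhat x i : ℂ)

/-- `B_l = b_l ∂v̂ + v̂ (∇b_l)ᵀ`. -/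
def B (l : Fin N) (x : Sp d) : Matrix (Fin d) (Fin d) ℝ :=
  P.b l x • jac P.vhat x + Matrix.vecMulVec (P.vhat x).ofLp (P.gradb l x).ofLp

/-- `∂F(x, y) = I + ∑ l, √μ_l B_l(x) y_l`. -/
def dF (y : Fin N → ℝ) (x : Sp d) : Matrix (Fin d) (Fin d) ℝ :=
  1 + ∑ l, (√(P.mu l) * y l) • P.B l x

/-- `∂F(x, z) = I + ∑ l, √μ_l B_l(x) z_l` for a complex parameter `z`. -/
def dFC (z : Fin N → ℂ) (x : Sp d) : Matrix (Fin d) (Fin d) ℂ :=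
  1 + ∑ l, ((√(P.mu l) : ℂ) * z l) • (P.B l x).map (fun r : ℝ => (r : ℂ))

/-- `G(z) = (a ∘ F) det(∂F(z)) ∂F(z)⁻¹ ∂F(z)⁻ᵀ`; `aF` is the function `a ∘ F` on `U`. -/
def G (aF : Sp d → ℝ) (z : Fin N → ℂ) (x : Sp d) : Matrix (Fin d) (Fin d) ℂ :=
  ((aF x : ℂ) * (P.dFC z x).det) • ((P.dFC z x)⁻¹ * ((P.dFC z x)⁻¹)ᵀ)

/-- The region `Θ_β ⊆ ℂ^N`; the supremum over `U` is the essential one. -/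
def Theta (U : Set (Sp d)) (β : ℝ) : Set (Fin N → ℂ) :=
  {z | ∃ (y : Fin N → ℝ) (w : Fin N → ℂ), (∀ l, y l ∈ Set.Icc (-1 : ℝ) 1) ∧
    (∀ l, z l = (y l : ℂ) + w l) ∧
    ∑ l, essSup (fun x => ENNReal.ofReal (specNorm (P.B l x))) (muOn U) *
      ENNReal.ofReal (√(P.mu l) * ‖w l‖) ≤ ENNReal.ofReal β}

/-- `û ∈ H¹₀(U)` solves, for the real parameter `y`,
`∫ (a ∘ F) ∇ûᵀ C⁻¹ ∇v |∂F| = ∫ (f ∘ F) v |∂F| - ∫ (a ∘ F) ∇ŵᵀ C⁻¹ ∇v |∂F|` for all `v ∈ H¹₀(U)`,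
where `C = ∂Fᵀ ∂F` and `|∂F|` is the absolute value of the Jacobian determinant. -/
def IsSolution (U : Set (Sp d)) (aF : Sp d → ℝ) (f : Sp d → ℝ) (gradw : Sp d → Sp d)
    (y : Fin N → ℝ) (u : H10 ℝ U) : Prop :=
  IsWeakSolution U (fun x => (aF x * |(P.dF y x).det|) • ((P.dF y x)ᵀ * P.dF y x)⁻¹)
    (fun x => f (P.F y x) * |(P.dF y x).det|) (fun x => (gradw x).ofLp) u

/-- The same problem for a complex parameter `z`: `u ∈ H¹₀(U; ℂ)` solves
`∫ ∇uᵀ G(z) ∇v = ∫ (f ∘ F)(z) det(∂F(z)) v - ∫ ∇ŵᵀ G(z) ∇v` for all `v ∈ H¹₀(U; ℂ)`.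
Here `fC` is the analytic extension of `f` to `ℂ^d`. -/
def IsSolutionC (U : Set (Sp d)) (aF : Sp d → ℝ) (fC : (Fin d → ℂ) → ℂ) (gradw : Sp d → Sp d)
    (z : Fin N → ℂ) (u : H10 ℂ U) : Prop :=
  IsWeakSolution U (P.G aF z) (fun x => fC (P.FC z x) * (P.dFC z x).det)
    (fun x i => (gradw x i : ℂ)) u

end MapData

/-! ### The constants -/

/-- `γ = (2 δ^d + (2-δ)^d) / (δ^d + (2-δ)^d)`. -/
def gammaC (δ : ℝ) (d : ℕ) : ℝ := (2 * δ ^ d + (2 - δ) ^ d) / (δ ^ d + (2 - δ) ^ d)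

/-- `α = 2 - exp(d β / (δ - β))`. -/
def alphaC (δ β : ℝ) (d : ℕ) : ℝ := 2 - Real.exp (d * β / (δ - β))

/-- The lower bound for `λ_min(Re G(z)⁻¹)`. -/
def constB (δ β : ℝ) (d : ℕ) (amax : ℝ) : ℝ :=
  (δ ^ (d + 1) * alphaC δ β d * (δ - 2 * β)
      - 2 * β * (2 + (β - δ)) * (1 - alphaC δ β d) * (2 - δ) ^ d)
    / (amax * (2 - δ) ^ (2 * d) * (2 - alphaC δ β d) ^ 2)

/-- The upper bound for `λ_max(Re G(z)⁻¹)`. -/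
def constD (δ β : ℝ) (d : ℕ) (amin : ℝ) : ℝ :=
  1 / (amin * δ ^ (2 * d) * alphaC δ β d ^ 2)
    * ((2 - δ) ^ d * (2 - alphaC δ β d) * (2 - δ + β) ^ 2
      + 2 * (1 - δ) ^ d * (2 - alphaC δ β d) * (β * (2 + (β - δ))))

/-- The upper bound for `σ_max(Im G(z)⁻¹)`. -/
def constC (δ β : ℝ) (d : ℕ) (amin : ℝ) : ℝ :=
  1 / (amin * δ ^ (2 * d) * alphaC δ β d ^ 2)
    * ((2 - δ) ^ d * (2 - alphaC δ β d) * (2 * β * (2 + (β - δ)))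
      + (2 - δ) ^ d * (1 - alphaC δ β d) * (((2 - δ) + β) ^ 2 + β ^ 2))

/-- `ε = 1 / ((1 + (C/B)²) D)`. -/
def epsC (δ β : ℝ) (d : ℕ) (amax amin : ℝ) : ℝ :=
  1 / ((1 + (constC δ β d amin / constB δ β d amax) ^ 2) * constD δ β d amin)

/-- The numerator of the estimate; `nf` and `nw` are the norms of `(f ∘ F)(z)` and of `∇ŵ`. -/
def constE (nf nw amax δ α : ℝ) (d : ℕ) (CP : ℝ) : ℝ :=
  (2 - α) * (nw / (amax⁻¹ * ((2 - δ) ^ d)⁻¹ * δ ^ 2) + CP * nf)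

end

/-! ### Determinants and inverses of perturbations of the identity -/

section MatrixBounds

open scoped Matrix.Norms.L2Operator

variable {d : ℕ}

/-! Write `A = ∂F(z)`. For `z` in `Θ_β`, `A = 1 + E + W` with `E` real, `‖E‖ ≤ 1 - δ` and `‖W‖ ≤ β`;
for nearby parameters `W` is only slightly larger. The proof studies not `G` but its explicit
inverse `(a det A)⁻¹ AᵀA`, which is complex symmetric.

The determinant splits as `det (1 + E) · ξ`. The first factor is real and lies in `[δ^d, (2 -
δ)^d]`, and `|ξ - 1| ≤ 1 - α`; both facts come from writing `det (1 + E)` as a product over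
eigenvalues. Applied to a real vector, `A` has real part of length between `δ - β` and `2 - δ + β`
and imaginary part of length at most `β` (times the length of the vector). Hence the real part `P`
and imaginary part `Q` of `G⁻¹` satisfy `B ≤ P ≤ D'` and `|Q| ≤ C`, with `D' = normInvBound`
(`IsPerturbed.coef_bounds`). Formally `Re G = (P + Q P⁻¹ Q)⁻¹`, so `Re G ≥ 1 / K` with `K = D' + C²
/ B` (`sq_norm_le_of_forms`, `IsPerturbed.re_diffusionMat_lower`).

This `K` is smaller than `1 / ε`, and the difference is needed. The energy estimate produces `(δ -
β)⁻²` and `(2 - δ)^d` where `E` has `δ⁻²` and `1`. The factor `gainC`, which satisfies `gainC * K ≤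
1 / ε`, dominates both discrepancies (`AdmissibleConsts.estimate_le`).

Coercivity and the Poincaré inequality make `∇* G ∇` invertible on `H¹₀` (`isUnit_divOp`), so the
solution is this inverse applied to the right hand side. The coefficient and the load are
holomorphic in `z` pointwise in `x` and uniformly bounded near each point of `Θ_β`, hence
holomorphic into `L^∞` (`differentiableAt_toLInf`). Inversion of operators is holomorphic on the
open set of units, so the solution is holomorphic too. For real `y`, taking real parts and
complexifying translates between the real and the complex weak problem. -/

theorem exists_det_one_add_eq_prod (E : Matrix (Fin d) (Fin d) ℂ) :
    ∃ ev : Fin d → ℂ, (∀ i, ‖ev i‖ ≤ ‖E‖) ∧ (1 + E).det = ∏ i, (1 + ev i) := by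
  -- The spectral bound below needs `‖1‖ = 1`, which fails for empty matrices.
  rcases Nat.eq_zero_or_pos d with rfl | hd
  · exact ⟨0, fun i => i.elim0, by simp⟩
  have : Nonempty (Fin d) := ⟨⟨0, hd⟩⟩
  have hdet := (1 + E).det_eq_prod_roots_charpoly
  have hcard : (1 + E).charpoly.roots.card = d := by
    rw [IsAlgClosed.card_roots_eq_natDegree, Matrix.charpoly_natDegree_eq_dim, Fintype.card_fin]
  -- The `ev i` will be the eigenvalues of `1 + E` shifted by one, which lie in the spectrum of `E`
  -- and so in the disc of radius `‖E‖`.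
  have hroot : ∀ r ∈ (1 + E).charpoly.roots, ‖r - 1‖ ≤ ‖E‖ := by
    intro r hr
    have h1 : r ∈ spectrum ℂ (1 + E) :=
      Matrix.mem_spectrum_iff_isRoot_charpoly.mpr (Polynomial.isRoot_of_mem_roots hr)
    have h2 : r - 1 ∈ spectrum ℂ E := by
      rw [spectrum.mem_iff] at h1 ⊢
      convert h1 using 2
      simp [map_sub, sub_sub]
    exact spectrum.norm_le_norm_of_mem h2
  generalize (1 + E).charpoly.roots = s at *
  induction s using Quotient.inductionOn with
  | h l =>
    simp only [Multiset.quot_mk_to_coe, Multiset.coe_card, Multiset.prod_coe, Multiset.mem_coe] at *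
    subst hcard
    refine ⟨fun i => l.get i - 1, fun i => hroot _ (l.get_mem i), ?_⟩
    rw [hdet]
    simp [Fin.prod_univ_def]

theorem norm_det_one_add_sub_one_le (E : Matrix (Fin d) (Fin d) ℂ) :
    ‖(1 + E).det - 1‖ ≤ Real.exp (d * ‖E‖) - 1 := by
  obtain ⟨ev, hev, h⟩ := exists_det_one_add_eq_prod E
  rw [h]
  refine (Finset.norm_prod_one_add_sub_one_le Finset.univ ev).trans ?_
  gcongr
  calc ∑ i, ‖ev i‖ ≤ ∑ _i : Fin d, ‖E‖ := Finset.sum_le_sum fun i _ => hev i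
    _ = d * ‖E‖ := by simp

theorem norm_det_one_add_le {E : Matrix (Fin d) (Fin d) ℂ} {δ : ℝ} (hE : ‖E‖ ≤ 1 - δ) :
    ‖(1 + E).det‖ ≤ (2 - δ) ^ d := by
  obtain ⟨ev, hev, h⟩ := exists_det_one_add_eq_prod E
  rw [h, norm_prod]
  calc ∏ i, ‖1 + ev i‖ ≤ ∏ _i : Fin d, (2 - δ) := by
        refine Finset.prod_le_prod (fun i _ => norm_nonneg _) fun i _ => ?_
        have := norm_add_le 1 (ev i)
        rw [norm_one] at this
        linarith [hev i]
    _ = (2 - δ) ^ d := by simp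

theorem le_norm_det_one_add {E : Matrix (Fin d) (Fin d) ℂ} {δ : ℝ} (hδ : 0 ≤ δ)
    (hE : ‖E‖ ≤ 1 - δ) : δ ^ d ≤ ‖(1 + E).det‖ := by
  obtain ⟨ev, hev, h⟩ := exists_det_one_add_eq_prod E
  rw [h, norm_prod]
  calc δ ^ d = ∏ _i : Fin d, δ := by simp
    _ ≤ ∏ i, ‖1 + ev i‖ := by
        refine Finset.prod_le_prod (fun i _ => hδ) fun i _ => ?_
        have := norm_sub_norm_le (1 : ℂ) (-ev i)
        rw [norm_one, norm_neg, sub_neg_eq_add] at this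
        linarith [hev i]

/-- The complexification of a real matrix. -/
noncomputable abbrev toC (M : Matrix (Fin d) (Fin d) ℝ) : Matrix (Fin d) (Fin d) ℂ :=
  M.map (fun r : ℝ => (r : ℂ))

theorem toC_add (M M' : Matrix (Fin d) (Fin d) ℝ) : toC (M + M') = toC M + toC M' := by
  ext; simp

theorem toC_one : toC (1 : Matrix (Fin d) (Fin d) ℝ) = 1 := by
  ext i j; by_cases h : i = j <;> simp [h, Matrix.one_apply]

theorem det_toC (M : Matrix (Fin d) (Fin d) ℝ) : (toC M).det = (M.det : ℂ) :=
  (Complex.ofRealHom.map_det M).symm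

/-- With the converse that follows, this expresses the operator norm in coordinates, where real and
imaginary parts can be compared entry by entry. -/
theorem sum_norm_mulVec_sq_le {𝕜 : Type*} [RCLike 𝕜] (M : Matrix (Fin d) (Fin d) 𝕜)
    (x : Fin d → 𝕜) : ∑ i, ‖(M *ᵥ x) i‖ ^ 2 ≤ ‖M‖ ^ 2 * ∑ i, ‖x i‖ ^ 2 := by
  have h := (Matrix.toEuclideanCLM (n := Fin d) (𝕜 := 𝕜) M).le_opNorm (WithLp.toLp 2 x)
  rw [Matrix.l2_opNorm_toEuclideanCLM, Matrix.toEuclideanCLM_toLp] at h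
  have h2 := pow_le_pow_left₀ (norm_nonneg _) h 2
  rwa [mul_pow, EuclideanSpace.norm_sq_eq, EuclideanSpace.norm_sq_eq] at h2

theorem norm_le_of_sum_norm_mulVec_sq_le {𝕜 : Type*} [RCLike 𝕜] {M : Matrix (Fin d) (Fin d) 𝕜}
    {c : ℝ} (hc : 0 ≤ c) (h : ∀ x : Fin d → 𝕜, ∑ i, ‖(M *ᵥ x) i‖ ^ 2 ≤ c ^ 2 * ∑ i, ‖x i‖ ^ 2) :
    ‖M‖ ≤ c := by
  rw [← Matrix.l2_opNorm_toEuclideanCLM]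
  refine ContinuousLinearMap.opNorm_le_bound _ hc fun x => ?_
  refine le_of_sq_le_sq ?_ (by positivity)
  rw [mul_pow, EuclideanSpace.norm_sq_eq, EuclideanSpace.norm_sq_eq]
  exact h x.ofLp

/-- A real matrix acts separately on the real and imaginary parts of a vector, whose squared norms
add up. -/
theorem norm_toC_le (M : Matrix (Fin d) (Fin d) ℝ) : ‖toC M‖ ≤ ‖M‖ := by
  refine norm_le_of_sum_norm_mulVec_sq_le (norm_nonneg _) fun x => ?_
  have hre : ∀ i, ((toC M *ᵥ x) i).re = (M *ᵥ fun j => (x j).re) i := fun i => by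
    simp [Matrix.mulVec, dotProduct]
  have him : ∀ i, ((toC M *ᵥ x) i).im = (M *ᵥ fun j => (x j).im) i := fun i => by
    simp [Matrix.mulVec, dotProduct]
  have hsq : ∀ z : ℂ, ‖z‖ ^ 2 = ‖z.re‖ ^ 2 + ‖z.im‖ ^ 2 := fun z => by
    rw [Complex.sq_norm, Complex.normSq_apply, Real.norm_eq_abs, Real.norm_eq_abs, sq_abs, sq_abs]
    ring
  simp_rw [hsq, hre, him, Finset.sum_add_distrib, mul_add]
  exact add_le_add (sum_norm_mulVec_sq_le M _) (sum_norm_mulVec_sq_le M _)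

theorem mulVec_ofReal_re (W : Matrix (Fin d) (Fin d) ℂ) (x : Fin d → ℝ) (i : Fin d) :
    ((W *ᵥ fun j => (x j : ℂ)) i).re = (W.map Complex.re *ᵥ x) i := by
  simp [Matrix.mulVec, dotProduct]

theorem mulVec_ofReal_im (W : Matrix (Fin d) (Fin d) ℂ) (x : Fin d → ℝ) (i : Fin d) :
    ((W *ᵥ fun j => (x j : ℂ)) i).im = (W.map Complex.im *ᵥ x) i := by
  simp [Matrix.mulVec, dotProduct]

theorem norm_map_re_le (W : Matrix (Fin d) (Fin d) ℂ) : ‖W.map Complex.re‖ ≤ ‖W‖ := by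
  refine norm_le_of_sum_norm_mulVec_sq_le (norm_nonneg _) fun x => ?_
  have h := sum_norm_mulVec_sq_le W fun j => (x j : ℂ)
  simp_rw [Complex.norm_real] at h
  refine le_trans (Finset.sum_le_sum fun i _ => ?_) h
  rw [← mulVec_ofReal_re, Real.norm_eq_abs]
  gcongr
  exact Complex.abs_re_le_norm _

theorem norm_map_im_le (W : Matrix (Fin d) (Fin d) ℂ) : ‖W.map Complex.im‖ ≤ ‖W‖ := by
  refine norm_le_of_sum_norm_mulVec_sq_le (norm_nonneg _) fun x => ?_
  have h := sum_norm_mulVec_sq_le W fun j => (x j : ℂ)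
  simp_rw [Complex.norm_real] at h
  refine le_trans (Finset.sum_le_sum fun i _ => ?_) h
  rw [← mulVec_ofReal_im, Real.norm_eq_abs]
  gcongr
  exact Complex.abs_im_le_norm _

/-- If `A v = x` then `v = x - (A - 1) v`, so `‖v‖ ≤ ‖x‖ + (1 - c) ‖v‖`. -/
theorem norm_inv_le_of_norm_sub_one_le {A : Matrix (Fin d) (Fin d) ℂ} {c : ℝ} (hc : 0 < c)
    (hA : ‖A - 1‖ ≤ 1 - c) (hdet : A.det ≠ 0) : ‖A⁻¹‖ ≤ c⁻¹ := by
  have hu : IsUnit A.det := isUnit_iff_ne_zero.mpr hdet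
  rw [← Matrix.l2_opNorm_toEuclideanCLM]
  refine ContinuousLinearMap.opNorm_le_bound _ (by positivity) fun x => ?_
  set T := fun M : Matrix (Fin d) (Fin d) ℂ => Matrix.toEuclideanCLM (n := Fin d) (𝕜 := ℂ) M
  set v := T A⁻¹ x with hv
  have h1 : T (A - 1) v + v = x := by
    have : T A v = x := by
      rw [hv]
      change (T A * T A⁻¹) x = x
      simp only [T]
      rw [← map_mul, Matrix.mul_nonsing_inv _ hu, map_one]
      rfl
    simp only [T, map_sub, map_one] at this ⊢
    simp [this]
  have h2 : ‖T (A - 1) v‖ ≤ (1 - c) * ‖v‖ :=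
    ((T (A - 1)).le_opNorm v).trans (by gcongr; exact hA)
  have h3 : ‖v‖ ≤ ‖x‖ + (1 - c) * ‖v‖ := by
    calc ‖v‖ = ‖x - T (A - 1) v‖ := by rw [← h1]; simp
      _ ≤ _ := (norm_sub_le _ _).trans (by gcongr)
  rw [← div_eq_inv_mul, le_div_iff₀ hc]
  linarith

/-- Along the segment from `1` to `1 + E` the determinant stays away from zero and starts at `1`, so
it cannot change sign. This is what lets `|∂F|` be replaced by the holomorphic `det ∂F`. -/
theorem det_one_add_pos {E : Matrix (Fin d) (Fin d) ℝ} {δ : ℝ} (hδ : 0 < δ)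
    (hE : ‖E‖ ≤ 1 - δ) : 0 < (1 + E).det := by
  have hne : ∀ t ∈ Set.Icc (0 : ℝ) 1, (1 + t • E).det ≠ 0 := by
    intro t ht h0
    have hn : ‖toC (t • E)‖ ≤ 1 - δ := by
      refine (norm_toC_le _).trans ?_
      rw [norm_smul, Real.norm_of_nonneg ht.1]
      exact (mul_le_of_le_one_left (norm_nonneg _) ht.2).trans hE
    have := le_norm_det_one_add hδ.le hn
    rw [← toC_one, ← toC_add, det_toC, h0, Complex.ofReal_zero, norm_zero] at this
    exact absurd this (not_le.mpr (pow_pos hδ d))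
  have hcont : ContinuousOn (fun t : ℝ => (1 + t • E).det) (Set.Icc 0 1) :=
    Continuous.continuousOn (by fun_prop)
  by_contra hneg
  push Not at hneg
  obtain ⟨t, ht, h0⟩ := intermediate_value_Icc' zero_le_one hcont
    (show (0 : ℝ) ∈ Set.Icc _ _ by simpa using hneg)
  exact hne t ht h0

end MatrixBounds

/-! ### Inequalities between the constants -/

section Constants

/-- The conditions on the constants in the theorem. -/
structure AdmissibleConsts (d : ℕ) (δ β amin amax : ℝ) : Prop where
  dim_pos : 0 < d
  δ_pos : 0 < δ
  δ_lt_one : δ < 1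
  β_pos : 0 < β
  β_lt_log : β < δ * Real.log (gammaC δ d) / (d + Real.log (gammaC δ d))
  β_lt_sqrt : β < √(1 + δ ^ 2 / 2) - 1
  amin_pos : 0 < amin
  amin_le_amax : amin ≤ amax

/-- An upper bound for `‖G(z)⁻¹‖`. -/
noncomputable def normInvBound (δ β : ℝ) (d : ℕ) (amin : ℝ) : ℝ :=
  (2 - δ + β) ^ 2 / (amin * δ ^ d * alphaC δ β d)

/-- The reciprocal of a lower bound for `Re G(z)`. -/
noncomputable def coerConst (δ β : ℝ) (d : ℕ) (amin amax : ℝ) : ℝ :=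
  normInvBound δ β d amin + constC δ β d amin ^ 2 / constB δ β d amax

/-- The gain of `(coerConst)⁻¹` over `epsC`. -/
noncomputable def gainC (δ β : ℝ) (d : ℕ) : ℝ :=
  (2 - δ) ^ d * (2 - alphaC δ β d) / (δ ^ d * alphaC δ β d)

namespace AdmissibleConsts

variable {d : ℕ} {δ β amin amax : ℝ} (h : AdmissibleConsts d δ β amin amax)

include h

/-- The square root condition on `β`, squared. Exactly this expression decides the sign of the
numerator of `constB`. -/
theorem quad_lt : 4 * β + 2 * β ^ 2 < δ ^ 2 := by
  have h1 : 1 + β < √(1 + δ ^ 2 / 2) := by linarith [h.β_lt_sqrt]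
  rw [Real.lt_sqrt (by linarith [h.β_pos])] at h1
  nlinarith

theorem four_mul_lt : 4 * β < δ := by
  nlinarith [h.quad_lt, h.δ_pos, h.δ_lt_one, sq_nonneg β]

theorem β_lt_δ : β < δ := by linarith [h.four_mul_lt, h.β_pos]

/-- The logarithmic condition on `β`, solved for `d * β / (δ - β) < log γ`. -/
theorem exp_lt_gamma : Real.exp (d * β / (δ - β)) < gammaC δ d := by
  have hδd : 0 < δ ^ d := pow_pos h.δ_pos d
  have hd2 : 0 < (2 - δ) ^ d := pow_pos (by linarith [h.δ_lt_one]) d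
  have hγ : 1 < gammaC δ d := by
    rw [gammaC, lt_div_iff₀ (by positivity)]
    linarith
  have hlog : 0 < Real.log (gammaC δ d) := Real.log_pos hγ
  rw [← Real.lt_log_iff_exp_lt (by linarith), div_lt_iff₀ (by linarith [h.β_lt_δ])]
  have := h.β_lt_log
  rw [lt_div_iff₀ (by positivity)] at this
  linarith

theorem alpha_lt_one : alphaC δ β d < 1 := by
  have hd : (0 : ℝ) < d := Nat.cast_pos.mpr h.dim_pos
  have : 0 < d * β / (δ - β) :=
    div_pos (mul_pos hd h.β_pos) (by linarith [h.β_lt_δ])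
  have := Real.one_lt_exp_iff.mpr this
  rw [alphaC]
  linarith

/-- Since `γ - 1 = δ^d / (δ^d + (2 - δ)^d)`, this is `1 - α < γ - 1` with denominators cleared. -/
theorem one_sub_alpha_mul_lt :
    (1 - alphaC δ β d) * (2 - δ) ^ d < alphaC δ β d * δ ^ d := by
  have hδd : 0 < δ ^ d := pow_pos h.δ_pos d
  have hd2 : 0 < (2 - δ) ^ d := pow_pos (by linarith [h.δ_lt_one]) d
  have := h.exp_lt_gamma
  rw [gammaC, lt_div_iff₀ (by positivity)] at this
  rw [alphaC]
  linarith

theorem alpha_pos : 0 < alphaC δ β d := by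
  have hδd : 0 < δ ^ d := pow_pos h.δ_pos d
  have hd2 : 0 < (2 - δ) ^ d := pow_pos (by linarith [h.δ_lt_one]) d
  have h1 := h.one_sub_alpha_mul_lt
  have h2 := mul_nonneg (sub_nonneg.mpr h.alpha_lt_one.le) hd2.le
  exact pos_of_mul_pos_left (h2.trans_lt h1) hδd.le

theorem one_le_pow_two_sub : 1 ≤ (2 - δ) ^ d := one_le_pow₀ (by linarith [h.δ_lt_one])

theorem pow_le_one : δ ^ d ≤ 1 := pow_le_one₀ h.δ_pos.le h.δ_lt_one.le

/-- By `one_sub_alpha_mul_lt` the numerator is at least `α δ^d` times `δ (δ - 2β) - 2β (2 + β - δ) =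
δ² - 4β - 2β²`, which `quad_lt` makes positive. -/
theorem constB_num_pos :
    0 < δ ^ (d + 1) * alphaC δ β d * (δ - 2 * β)
      - 2 * β * (2 + (β - δ)) * (1 - alphaC δ β d) * (2 - δ) ^ d := by
  have hδd : 0 < δ ^ d := pow_pos h.δ_pos d
  have h1 := h.one_sub_alpha_mul_lt
  have h2 : 0 < 2 * β * (2 + (β - δ)) :=
    mul_pos (by linarith [h.β_pos]) (by linarith [h.β_pos, h.δ_lt_one])
  have h3 := mul_le_mul_of_nonneg_left h1.le h2.le
  have h4 : 0 < alphaC δ β d * δ ^ d * (δ ^ 2 - 4 * β - 2 * β ^ 2) :=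
    mul_pos (mul_pos h.alpha_pos hδd) (by linarith [h.quad_lt])
  rw [pow_succ]
  linarith

theorem amax_pos : 0 < amax := h.amin_pos.trans_le h.amin_le_amax

theorem constB_pos : 0 < constB δ β d amax := by
  have := h.amax_pos
  have h1 : 0 < 2 - δ := by linarith [h.δ_lt_one]
  have h2 : 0 < 2 - alphaC δ β d := by linarith [h.alpha_lt_one]
  exact div_pos h.constB_num_pos (by positivity)

theorem normInvBound_pos : 0 < normInvBound δ β d amin := by
  have := h.amin_pos
  have := h.δ_pos
  have := h.alpha_pos
  have h1 : 0 < 2 - δ + β := by linarith [h.δ_lt_one, h.β_pos]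
  unfold normInvBound
  positivity

/-- The chain is `B ≤ 1 / amax ≤ 1 / amin ≤ normInvBound`. -/
theorem constB_le_normInvBound : constB δ β d amax ≤ normInvBound δ β d amin := by
  have hα := h.alpha_pos
  have hα1 := h.alpha_lt_one
  have hδd : 0 < δ ^ d := pow_pos h.δ_pos d
  have ha := h.amin_pos
  have ha' := h.amax_pos
  have e1 : constB δ β d amax ≤ 1 / amax := by
    rw [constB, div_le_div_iff₀ (by
      have h1 : 0 < 2 - δ := by linarith [h.δ_lt_one]
      have h2 : 0 < 2 - alphaC δ β d := by linarith
      positivity) ha', one_mul, mul_assoc amax, mul_comm _ amax]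
    have h5 : 1 ≤ (2 - δ) ^ (2 * d) := one_le_pow₀ (by linarith [h.δ_lt_one])
    have h6 : 1 ≤ (2 - alphaC δ β d) ^ 2 := one_le_pow₀ (by linarith)
    have h7 : 0 ≤ 2 * β * (2 + (β - δ)) * (1 - alphaC δ β d) * (2 - δ) ^ d := by
      have h1 : 0 ≤ 2 - δ := by linarith [h.δ_lt_one]
      have h2 : 0 ≤ 2 + (β - δ) := by linarith [h.δ_lt_one, h.β_pos]
      have h3 : 0 ≤ 1 - alphaC δ β d := by linarith
      have := h.β_pos
      positivity
    have h8 : δ ^ (d + 1) * alphaC δ β d * (δ - 2 * β) ≤ 1 := by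
      have h9 : δ ^ (d + 1) ≤ 1 := pow_le_one₀ h.δ_pos.le h.δ_lt_one.le
      have h10 : δ ^ (d + 1) * alphaC δ β d ≤ 1 := mul_le_one₀ h9 hα.le hα1.le
      exact mul_le_one₀ h10 (by linarith [h.four_mul_lt, h.β_pos])
        (by linarith [h.δ_lt_one, h.β_pos])
    have h11 : 1 ≤ (2 - δ) ^ (2 * d) * (2 - alphaC δ β d) ^ 2 :=
      one_le_mul_of_one_le_of_one_le h5 h6
    exact mul_le_mul_of_nonneg_left (by linarith) ha'.le
  refine e1.trans ((one_div_le_one_div_of_le ha h.amin_le_amax).trans ?_)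
  rw [normInvBound, div_le_div_iff₀ ha (by positivity), one_mul, mul_comm _ amin, mul_assoc]
  refine mul_le_mul_of_nonneg_left ?_ ha.le
  exact (mul_le_one₀ h.pow_le_one hα.le hα1.le).trans
    (one_le_pow₀ (by linarith [h.δ_lt_one, h.β_pos]))

/-- The left side is precisely the first summand of `constD`; `gainC` is defined to make this so. -/
theorem gainC_mul_normInvBound_le : gainC δ β d * normInvBound δ β d amin ≤ constD δ β d amin := by
  have hα := h.alpha_pos
  have hα1 := h.alpha_lt_one
  have hδ := h.δ_pos
  have ha := h.amin_pos
  have hβ := h.β_pos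
  have e : gainC δ β d * normInvBound δ β d amin = 1 / (amin * δ ^ (2 * d) * alphaC δ β d ^ 2)
      * ((2 - δ) ^ d * (2 - alphaC δ β d) * (2 - δ + β) ^ 2) := by
    rw [gainC, normInvBound, mul_comm 2 d, pow_mul]
    field_simp
  rw [e, constD]
  have h1 : 0 ≤ 1 - δ := by linarith [h.δ_lt_one]
  have h2 : 0 ≤ 2 - alphaC δ β d := by linarith
  have h3 : 0 ≤ 2 + (β - δ) := by linarith
  gcongr
  exact le_add_of_nonneg_right (by positivity)

theorem gainC_pos : 0 < gainC δ β d := by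
  have hα := h.alpha_pos
  have hδ := h.δ_pos
  have h1 : 0 < 2 - δ := by linarith [h.δ_lt_one]
  have h2 : 0 < 2 - alphaC δ β d := by linarith [h.alpha_lt_one]
  unfold gainC
  positivity

theorem constD_pos : 0 < constD δ β d amin :=
  (mul_pos h.gainC_pos h.normInvBound_pos).trans_le h.gainC_mul_normInvBound_le

theorem epsC_pos : 0 < epsC δ β d amax amin := by
  have := h.constD_pos
  unfold epsC
  positivity

theorem coerConst_pos : 0 < coerConst δ β d amin amax := by
  have := h.normInvBound_pos
  have := h.constB_pos
  unfold coerConst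
  positivity

/-- The term `gainC * C² / B` equals `(C / B)² * (gainC * B)`, and `gainC * B ≤ gainC * normInvBound
≤ D`. The room gained over `epsC` is used in `estimate_le`. -/
theorem gainC_mul_coerConst_le :
    gainC δ β d * coerConst δ β d amin amax ≤ (epsC δ β d amax amin)⁻¹ := by
  have hB := h.constB_pos
  have hg := h.gainC_pos
  have h1 := h.gainC_mul_normInvBound_le
  have h2 : gainC δ β d * constB δ β d amax ≤ constD δ β d amin :=
    (mul_le_mul_of_nonneg_left h.constB_le_normInvBound hg.le).trans h1
  rw [epsC, one_div, inv_inv, coerConst, mul_add, add_mul, one_mul]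
  refine add_le_add h1 ?_
  calc gainC δ β d * (constC δ β d amin ^ 2 / constB δ β d amax)
      = (constC δ β d amin / constB δ β d amax) ^ 2 * (gainC δ β d * constB δ β d amax) := by
        field_simp
    _ ≤ _ := mul_le_mul_of_nonneg_left h2 (sq_nonneg _)

theorem pow_le_gainC : (2 - δ) ^ d ≤ gainC δ β d := by
  have hα := h.alpha_pos
  have hα1 := h.alpha_lt_one
  have hδd : 0 < δ ^ d := pow_pos h.δ_pos d
  rw [gainC, le_div_iff₀ (by positivity)]
  refine mul_le_mul_of_nonneg_left ?_ (zero_le_one.trans h.one_le_pow_two_sub)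
  exact (mul_le_one₀ h.pow_le_one hα.le hα1.le).trans (by linarith)

theorem one_le_gainC : 1 ≤ gainC δ β d := h.one_le_pow_two_sub.trans h.pow_le_gainC

/-- Here `δ / (δ - β) = 1 + β / (δ - β) ≤ exp (d β / (δ - β)) = 2 - α`, and `(2 - α)² ≤ gainC`
because `α (2 - α) ≤ 1` and `δ^d ≤ (2 - δ)^d`. -/
theorem sq_div_le_gainC : (δ / (δ - β)) ^ 2 ≤ gainC δ β d := by
  have hα := h.alpha_pos
  have hα1 := h.alpha_lt_one
  have hδd : 0 < δ ^ d := pow_pos h.δ_pos d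
  have hδβ : 0 < δ - β := by linarith [h.β_lt_δ]
  have hd1 : (1 : ℝ) ≤ d := Nat.one_le_cast.mpr h.dim_pos
  have e0 : δ / (δ - β) ≤ 2 - alphaC δ β d := by
    have h1 : δ / (δ - β) = β / (δ - β) + 1 := by field_simp; ring
    have h2 : β / (δ - β) ≤ d * β / (δ - β) := by
      gcongr
      exact le_mul_of_one_le_left h.β_pos.le hd1
    have h3 := Real.add_one_le_exp (d * β / (δ - β))
    rw [alphaC]
    linarith
  have e1 : (δ / (δ - β)) ^ 2 ≤ (2 - alphaC δ β d) ^ 2 := by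
    have : 0 ≤ δ / (δ - β) := div_nonneg h.δ_pos.le hδβ.le
    gcongr
  refine e1.trans ?_
  rw [gainC, le_div_iff₀ (by positivity)]
  have e2 : (2 - alphaC δ β d) * alphaC δ β d ≤ 1 := by nlinarith [sq_nonneg (alphaC δ β d - 1)]
  have e3 : δ ^ d ≤ (2 - δ) ^ d := h.pow_le_one.trans h.one_le_pow_two_sub
  have e4 : 0 < 2 - alphaC δ β d := by linarith
  calc (2 - alphaC δ β d) ^ 2 * (δ ^ d * alphaC δ β d)
      = δ ^ d * (2 - alphaC δ β d) * ((2 - alphaC δ β d) * alphaC δ β d) := by ring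
    _ ≤ δ ^ d * (2 - alphaC δ β d) * 1 := by gcongr
    _ ≤ (2 - δ) ^ d * (2 - alphaC δ β d) := by rw [mul_one]; gcongr

end AdmissibleConsts

end Constants

/-! ### Pointwise bounds for `G` -/

section PointwiseG

open scoped Matrix.Norms.L2Operator

variable {d : ℕ}

/-- The transpose is the adjoint of the entrywise conjugate, and conjugation preserves the norms of
vectors. -/
theorem norm_transpose_le (M : Matrix (Fin d) (Fin d) ℂ) : ‖Mᵀ‖ ≤ ‖M‖ := by
  have e : Mᵀ = (M.map star)ᴴ := by ext; simp
  rw [e, Matrix.l2_opNorm_conjTranspose]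
  refine norm_le_of_sum_norm_mulVec_sq_le (norm_nonneg _) fun x => ?_
  have h := sum_norm_mulVec_sq_le M (fun i => star (x i))
  simp_rw [norm_star] at h
  refine le_trans (le_of_eq (Finset.sum_congr rfl fun i _ => ?_)) h
  rw [← norm_star]
  simp [Matrix.mulVec, dotProduct]

/-- If `H = P + i Q` is symmetric with `B ≤ P ≤ D` and `|Q| ≤ C`, then
`(D + C²/B) Re H⁻¹ ≥ 1`. -/
theorem sq_norm_le_of_forms {E : Type*} [NormedAddCommGroup E] [NormedSpace ℝ E]
    (P : E →ₗ[ℝ] E →ₗ[ℝ] ℝ) (Q : E → E → ℝ) {B C D : ℝ} (hB : 0 < B) (hD : 0 < D)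
    (hPs : ∀ v w, P v w = P w v)
    (hPB : ∀ v, B * ‖v‖ ^ 2 ≤ P v v) (hPD : ∀ v, P v v ≤ D * ‖v‖ ^ 2)
    (hQs : ∀ v w, Q v w = Q w v) (hQ : ∀ v w, |Q v w| ≤ C * (‖v‖ * ‖w‖)) {x p q : E} {t : ℝ}
    (h1 : P x p - Q x q = ‖x‖ ^ 2) (h2 : P p p - Q p q = t) (h3 : Q q p + P q q = 0) :
    ‖x‖ ^ 2 ≤ (D + C ^ 2 / B) * t := by
  set K := D + C ^ 2 / B with hK
  have hK0 : 0 < K := by positivity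
  -- Positivity of `P` at `x - K p` bounds `2K P x p`; the next step bounds `-2K Q x q` by Young's
  -- inequality. The value `K = D + C² / B` makes the coefficients of `‖x‖²` sum to `K`.
  have e1 : 0 ≤ P x x - 2 * K * P x p + K ^ 2 * P p p := by
    have h := hPB (x - K • p)
    have h' : P (x - K • p) (x - K • p) = P x x - 2 * K * P x p + K ^ 2 * P p p := by
      simp only [map_sub, map_smul, LinearMap.sub_apply, LinearMap.smul_apply, smul_eq_mul,
        hPs p x]
      ring
    rw [← h']
    exact le_trans (by positivity) h
  have e2 : 2 * K * (-Q x q) ≤ C ^ 2 / B * ‖x‖ ^ 2 + K ^ 2 * P q q := by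
    have h4 : -Q x q ≤ C * (‖x‖ * ‖q‖) := (neg_le_abs _).trans (hQ x q)
    have h5 : 2 * K * (C * (‖x‖ * ‖q‖)) ≤ C ^ 2 / B * ‖x‖ ^ 2 + K ^ 2 * (B * ‖q‖ ^ 2) := by
      have : C ^ 2 / B * ‖x‖ ^ 2 + K ^ 2 * (B * ‖q‖ ^ 2) - 2 * K * (C * (‖x‖ * ‖q‖))
          = (C * ‖x‖ - K * B * ‖q‖) ^ 2 / B := by field_simp; ring
      have h6 : 0 ≤ (C * ‖x‖ - K * B * ‖q‖) ^ 2 / B := by positivity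
      linarith
    calc 2 * K * (-Q x q) ≤ 2 * K * (C * (‖x‖ * ‖q‖)) := by gcongr
      _ ≤ _ := h5
      _ ≤ _ := by gcongr; exact hPB q
  -- The relation `h3` trades the indefinite cross term `Q p q` for the nonnegative `P q q`.
  have e3 : P p p + P q q = t := by rw [hQs q p] at h3; linarith
  have e4 : 2 * K * ‖x‖ ^ 2 ≤ K * ‖x‖ ^ 2 + K ^ 2 * t := by
    rw [← e3]
    nth_rewrite 1 [← h1]
    have := hPD x
    calc 2 * K * (P x p - Q x q) = 2 * K * P x p + 2 * K * (-Q x q) := by ring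
      _ ≤ (D * ‖x‖ ^ 2 + K ^ 2 * P p p) + (C ^ 2 / B * ‖x‖ ^ 2 + K ^ 2 * P q q) := by linarith
      _ = _ := by rw [hK]; ring
  have e5 : K * ‖x‖ ^ 2 ≤ K * (K * t) := by linarith
  exact le_of_mul_le_mul_left e5 hK0

/-- The matrix `a det(A) A⁻¹ A⁻ᵀ`. -/
noncomputable def diffusionMat (a : ℝ) (A : Matrix (Fin d) (Fin d) ℂ) : Matrix (Fin d) (Fin d) ℂ :=
  ((a : ℂ) * A.det) • (A⁻¹ * A⁻¹ᵀ)

theorem diffusionMat_transpose (a : ℝ) (A : Matrix (Fin d) (Fin d) ℂ) :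
    (diffusionMat a A)ᵀ = diffusionMat a A := by
  simp [diffusionMat, Matrix.transpose_mul]

/-- The inverse of `G` contains no inverse matrix, so its real and imaginary parts can be bounded
directly. -/
theorem transpose_mul_self_mul_diffusionMat {a : ℝ} {A : Matrix (Fin d) (Fin d) ℂ} (ha : a ≠ 0)
    (hA : A.det ≠ 0) : ((((a : ℂ) * A.det)⁻¹) • (Aᵀ * A)) * diffusionMat a A = 1 := by
  have hu : IsUnit A.det := isUnit_iff_ne_zero.mpr hA
  have hne : (a : ℂ) * A.det ≠ 0 := mul_ne_zero (by exact_mod_cast ha) hA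
  rw [diffusionMat, Matrix.smul_mul, Matrix.mul_smul, smul_smul, inv_mul_cancel₀ hne, one_smul,
    Matrix.mul_assoc, Matrix.mul_nonsing_inv_cancel_left _ _ hu, ← Matrix.transpose_mul,
    Matrix.nonsing_inv_mul _ hu, Matrix.transpose_one]

/-- `A = I + E + W` with `E` real, `‖E‖ ≤ 1 - δ` and `‖W‖ ≤ b`. -/
structure IsPerturbed (δ b : ℝ) (E : Matrix (Fin d) (Fin d) ℝ) (A : Matrix (Fin d) (Fin d) ℂ) :
    Prop where
  norm_real : ‖E‖ ≤ 1 - δ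
  norm_sub : ‖A - toC (1 + E)‖ ≤ b

namespace IsPerturbed

variable {δ b β amin amax : ℝ} {E : Matrix (Fin d) (Fin d) ℝ} {A : Matrix (Fin d) (Fin d) ℂ}

theorem norm_sub_one (hA : IsPerturbed δ b E A) : ‖A - 1‖ ≤ 1 - (δ - b) := by
  have h1 : A - 1 = toC E + (A - toC (1 + E)) := by rw [toC_add, toC_one]; abel
  rw [h1]
  linarith [norm_add_le (toC E) (A - toC (1 + E)), norm_toC_le E, hA.norm_real, hA.norm_sub]

theorem det_real_pos (hA : IsPerturbed δ b E A) (hδ : 0 < δ) : 0 < (1 + E).det :=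
  det_one_add_pos hδ hA.norm_real

theorem le_det_real (hA : IsPerturbed δ b E A) (hδ : 0 < δ) : δ ^ d ≤ (1 + E).det := by
  have := le_norm_det_one_add hδ.le ((norm_toC_le E).trans hA.norm_real)
  rwa [← toC_one, ← toC_add, det_toC, Complex.norm_real,
    Real.norm_of_nonneg (hA.det_real_pos hδ).le] at this

theorem det_real_le (hA : IsPerturbed δ b E A) (hδ : 0 < δ) : (1 + E).det ≤ (2 - δ) ^ d := by
  have := norm_det_one_add_le ((norm_toC_le E).trans hA.norm_real)
  rwa [← toC_one, ← toC_add, det_toC, Complex.norm_real,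
    Real.norm_of_nonneg (hA.det_real_pos hδ).le] at this

variable (h : AdmissibleConsts d δ β amin amax)

include h

/-- Factor `A = (1 + E)(1 + (1 + E)⁻¹ W)`, where `‖(1 + E)⁻¹ W‖ ≤ b / δ`. As `α` is built from `β /
(δ - β) > β / δ`, the bound survives for some `b > β`, which gives holomorphy on a neighbourhood of
`Θ_β`. -/
theorem exists_det_eq (hA : IsPerturbed δ b E A) (hb : b / δ ≤ β / (δ - β)) :
    ∃ ξ : ℂ, A.det = ((1 + E).det : ℂ) * ξ ∧ ‖ξ - 1‖ ≤ 1 - alphaC δ β d := by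
  have hδ := h.δ_pos
  have hdet : (toC (1 + E)).det ≠ 0 := by
    rw [det_toC]
    exact_mod_cast (hA.det_real_pos hδ).ne'
  have hinv : ‖(toC (1 + E))⁻¹‖ ≤ δ⁻¹ := by
    refine norm_inv_le_of_norm_sub_one_le hδ ?_ hdet
    rw [toC_add, toC_one, add_sub_cancel_left]
    exact (norm_toC_le E).trans hA.norm_real
  refine ⟨(1 + (toC (1 + E))⁻¹ * (A - toC (1 + E))).det, ?_, ?_⟩
  · rw [← det_toC, ← Matrix.det_mul, mul_add, mul_one,
      Matrix.mul_nonsing_inv_cancel_left _ _ (isUnit_iff_ne_zero.mpr hdet)]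
    congr 1
    abel
  · refine (norm_det_one_add_sub_one_le _).trans ?_
    have h1 : ‖(toC (1 + E))⁻¹ * (A - toC (1 + E))‖ ≤ β / (δ - β) := by
      refine le_trans ?_ hb
      calc _ ≤ ‖(toC (1 + E))⁻¹‖ * ‖A - toC (1 + E)‖ := norm_mul_le _ _
        _ ≤ δ⁻¹ * b := by
          have := hA.norm_sub
          gcongr
        _ = b / δ := by ring
    have h2 : (d : ℝ) * ‖(toC (1 + E))⁻¹ * (A - toC (1 + E))‖ ≤ d * β / (δ - β) := by
      rw [mul_div_assoc]
      gcongr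
    rw [alphaC]
    linarith [Real.exp_le_exp.mpr h2]

theorem norm_det_le (hA : IsPerturbed δ b E A) (hb : b / δ ≤ β / (δ - β)) :
    ‖A.det‖ ≤ (2 - δ) ^ d * (2 - alphaC δ β d) := by
  obtain ⟨ξ, h1, h2⟩ := hA.exists_det_eq h hb
  rw [h1, norm_mul, Complex.norm_real, Real.norm_of_nonneg (hA.det_real_pos h.δ_pos).le]
  have h3 : ‖ξ‖ ≤ 2 - alphaC δ β d := by
    have := norm_sub_norm_le ξ 1
    rw [norm_one] at this
    linarith
  have h4 := (hA.det_real_pos h.δ_pos).le.trans (hA.det_real_le h.δ_pos)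
  have h5 := hA.det_real_le h.δ_pos
  gcongr

theorem le_norm_det (hA : IsPerturbed δ b E A) (hb : b / δ ≤ β / (δ - β)) :
    δ ^ d * alphaC δ β d ≤ ‖A.det‖ := by
  obtain ⟨ξ, h1, h2⟩ := hA.exists_det_eq h hb
  rw [h1, norm_mul, Complex.norm_real, Real.norm_of_nonneg (hA.det_real_pos h.δ_pos).le]
  have h3 : alphaC δ β d ≤ ‖ξ‖ := by
    have := norm_sub_norm_le 1 (1 - ξ)
    rw [norm_one, sub_sub_cancel, norm_sub_rev] at this
    linarith
  have := h.alpha_pos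
  have := (hA.det_real_pos h.δ_pos).le
  have := hA.le_det_real h.δ_pos
  gcongr

theorem det_ne_zero (hA : IsPerturbed δ b E A) (hb : b / δ ≤ β / (δ - β)) : A.det ≠ 0 := by
  rw [← norm_pos_iff]
  exact lt_of_lt_of_le (mul_pos (pow_pos h.δ_pos d) h.alpha_pos) (hA.le_norm_det h hb)

theorem norm_diffusionMat_le (hA : IsPerturbed δ b E A) (hb : b / δ ≤ β / (δ - β)) (hbδ : b < δ)
    {a : ℝ} (ha : amin ≤ a ∧ a ≤ amax) :
    ‖diffusionMat a A‖ ≤ amax * ((2 - δ) ^ d * (2 - alphaC δ β d)) * ((δ - b) ^ 2)⁻¹ := by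
  have h0 : 0 < δ - b := sub_pos.mpr hbδ
  have h1 := norm_inv_le_of_norm_sub_one_le h0 hA.norm_sub_one (hA.det_ne_zero h hb)
  have ha0 : 0 ≤ a := h.amin_pos.le.trans ha.1
  have h2 := hA.norm_det_le h hb
  have h3 := h.amax_pos
  rw [diffusionMat, norm_smul, norm_mul, Complex.norm_real, Real.norm_of_nonneg ha0]
  have h4 : ‖A⁻¹ * A⁻¹ᵀ‖ ≤ ((δ - b) ^ 2)⁻¹ := by
    rw [← inv_pow, pow_two]
    have := norm_transpose_le A⁻¹
    exact (norm_mul_le _ _).trans (mul_le_mul h1 (this.trans h1) (norm_nonneg _)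
      (inv_nonneg.mpr h0.le))
  exact mul_le_mul (mul_le_mul ha.2 h2 (norm_nonneg _) h3.le) h4 (norm_nonneg _)
    (mul_nonneg h3.le ((norm_nonneg _).trans h2))

end IsPerturbed

end PointwiseG

/-! ### Real and imaginary forms of the inverse of `G`, and coercivity of `Re G` -/

section FormBounds

open scoped Matrix.Norms.L2Operator

variable {d : ℕ}

/-- The embedding of `ℝ^d` into `ℂ^d`. -/
abbrev vecC (x : Sp d) : Fin d → ℂ := fun j => (x j : ℂ)

/-- The vector `Re (A x)` for real `x`. -/
noncomputable abbrev reApply (A : Matrix (Fin d) (Fin d) ℂ) (x : Sp d) : Sp d :=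
  Matrix.toEuclideanCLM (n := Fin d) (𝕜 := ℝ) (A.map Complex.re) x

/-- The vector `Im (A x)` for real `x`. -/
noncomputable abbrev imApply (A : Matrix (Fin d) (Fin d) ℂ) (x : Sp d) : Sp d :=
  Matrix.toEuclideanCLM (n := Fin d) (𝕜 := ℝ) (A.map Complex.im) x

theorem dotProduct_mulVec_vecC (A : Matrix (Fin d) (Fin d) ℂ) (x y : Sp d) :
    (A *ᵥ vecC x) ⬝ᵥ (A *ᵥ vecC y) =
      ⟨inner ℝ (reApply A x) (reApply A y) - inner ℝ (imApply A x) (imApply A y),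
        inner ℝ (reApply A x) (imApply A y) + inner ℝ (imApply A x) (reApply A y)⟩ := by
  have hre : ∀ (x : Sp d) i, ((A *ᵥ vecC x) i).re = reApply A x i := fun x i =>
    mulVec_ofReal_re A x.ofLp i
  have him : ∀ (x : Sp d) i, ((A *ᵥ vecC x) i).im = imApply A x i := fun x i =>
    mulVec_ofReal_im A x.ofLp i
  apply Complex.ext
  · simp only [dotProduct, Complex.re_sum, Complex.mul_re, hre, him, PiLp.inner_apply,
      RCLike.inner_apply, conj_trivial, Finset.sum_sub_distrib]
    simp only [mul_comm]
  · simp only [dotProduct, Complex.im_sum, Complex.mul_im, hre, him, PiLp.inner_apply,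
      RCLike.inner_apply, conj_trivial, Finset.sum_add_distrib]
    simp only [mul_comm]

/-- The real bilinear form `Re (c (A x)ᵀ (A y))`. -/
noncomputable def reForm (c : ℂ) (A : Matrix (Fin d) (Fin d) ℂ) : Sp d →ₗ[ℝ] Sp d →ₗ[ℝ] ℝ :=
  LinearMap.mk₂ ℝ (fun x y => (c * ((A *ᵥ vecC x) ⬝ᵥ (A *ᵥ vecC y))).re)
    (fun x x' y => by
      simp only [dotProduct_mulVec_vecC, map_add, inner_add_left, Complex.mul_re]; ring)
    (fun t x y => by
      simp only [dotProduct_mulVec_vecC, map_smul, real_inner_smul_left, Complex.mul_re,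
        smul_eq_mul]; ring)
    (fun x y y' => by
      simp only [dotProduct_mulVec_vecC, map_add, inner_add_right, Complex.mul_re]; ring)
    (fun t x y => by
      simp only [dotProduct_mulVec_vecC, map_smul, real_inner_smul_right, Complex.mul_re,
        smul_eq_mul]; ring)

/-- The real bilinear form `Im (c (A x)ᵀ (A y))`. -/
noncomputable def imForm (c : ℂ) (A : Matrix (Fin d) (Fin d) ℂ) (x y : Sp d) : ℝ :=
  (c * ((A *ᵥ vecC x) ⬝ᵥ (A *ᵥ vecC y))).im

theorem reForm_apply (c : ℂ) (A : Matrix (Fin d) (Fin d) ℂ) (x y : Sp d) :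
    reForm c A x y = (c * ((A *ᵥ vecC x) ⬝ᵥ (A *ᵥ vecC y))).re := rfl

theorem reForm_symm (c : ℂ) (A : Matrix (Fin d) (Fin d) ℂ) (x y : Sp d) :
    reForm c A x y = reForm c A y x := by
  rw [reForm_apply, reForm_apply, dotProduct_comm]

theorem imForm_symm (c : ℂ) (A : Matrix (Fin d) (Fin d) ℂ) (x y : Sp d) :
    imForm c A x y = imForm c A y x := by
  rw [imForm, imForm, dotProduct_comm]

namespace IsPerturbed

variable {δ β amin amax a : ℝ} {E : Matrix (Fin d) (Fin d) ℝ} {A : Matrix (Fin d) (Fin d) ℂ}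

theorem norm_reApply_sub_le (hA : IsPerturbed δ β E A) (x : Sp d) :
    ‖reApply A x - x‖ ≤ (1 - (δ - β)) * ‖x‖ := by
  have h1 : reApply A x - x
      = Matrix.toEuclideanCLM (n := Fin d) (𝕜 := ℝ) ((A - 1).map Complex.re) x := by
    have : (A - 1).map Complex.re = A.map Complex.re - 1 := by
      ext i j; by_cases h : i = j <;> simp [h]
    rw [this, map_sub, map_one]
    rfl
  rw [h1]
  refine (ContinuousLinearMap.le_opNorm _ _).trans ?_
  gcongr
  exact (norm_map_re_le _).trans hA.norm_sub_one

theorem norm_reApply_le (hA : IsPerturbed δ β E A) (x : Sp d) :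
    ‖reApply A x‖ ≤ (2 - δ + β) * ‖x‖ := by
  have := norm_sub_norm_le (reApply A x) x
  linarith [hA.norm_reApply_sub_le x]

theorem le_norm_reApply (hA : IsPerturbed δ β E A) (x : Sp d) :
    (δ - β) * ‖x‖ ≤ ‖reApply A x‖ := by
  have := norm_sub_norm_le x (reApply A x)
  rw [norm_sub_rev] at this
  linarith [hA.norm_reApply_sub_le x]

theorem norm_imApply_le (hA : IsPerturbed δ β E A) (x : Sp d) : ‖imApply A x‖ ≤ β * ‖x‖ := by
  refine (ContinuousLinearMap.le_opNorm _ _).trans ?_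
  gcongr
  -- The unperturbed matrix is real, so only the perturbation contributes.
  have h1 : A.map Complex.im = (A - toC (1 + E)).map Complex.im := by ext; simp
  rw [h1]
  exact (norm_map_im_le _).trans hA.norm_sub

theorem sq_norm_reApply_add_le (hA : IsPerturbed δ β E A) (x : Sp d) :
    ‖reApply A x‖ ^ 2 + ‖imApply A x‖ ^ 2 ≤ (2 - δ + β) ^ 2 * ‖x‖ ^ 2 := by
  have h1 : ‖A‖ ≤ 2 - δ + β := by
    rcases Nat.eq_zero_or_pos d with rfl | hd
    · have : A = A - toC (1 + E) := Subsingleton.elim _ _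
      have hs := hA.norm_sub
      rw [← this] at hs
      have : 0 ≤ 1 - δ := (norm_nonneg _).trans hA.norm_real
      linarith
    · have : Nonempty (Fin d) := ⟨⟨0, hd⟩⟩
      have h2 : ‖(1 : Matrix (Fin d) (Fin d) ℂ)‖ = 1 := norm_one
      have := norm_add_le (A - 1) 1
      rw [sub_add_cancel] at this
      linarith [hA.norm_sub_one]
  have h2 := sum_norm_mulVec_sq_le A (vecC x)
  have h3 : ∀ i, ‖(A *ᵥ vecC x) i‖ ^ 2 = ‖reApply A x i‖ ^ 2 + ‖imApply A x i‖ ^ 2 := fun i => by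
    rw [Complex.sq_norm, Complex.normSq_apply]
    have e1 : ((A *ᵥ vecC x) i).re = reApply A x i := mulVec_ofReal_re A x.ofLp i
    have e2 : ((A *ᵥ vecC x) i).im = imApply A x i := mulVec_ofReal_im A x.ofLp i
    rw [e1, e2, Real.norm_eq_abs, Real.norm_eq_abs, sq_abs, sq_abs]
    ring
  simp_rw [h3, Finset.sum_add_distrib, Complex.norm_real] at h2
  rw [← EuclideanSpace.norm_sq_eq, ← EuclideanSpace.norm_sq_eq, ← EuclideanSpace.norm_sq_eq] at h2
  refine h2.trans ?_
  gcongr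

variable (h : AdmissibleConsts d δ β amin amax)

include h

/-- With `d0 = det (1 + E)`, the scalar is `conj ξ / (a d0 |ξ|²)`, where `α ≤ Re ξ ≤ 2 - α` and `|Im
ξ| ≤ 1 - α`. The last two bounds are stated in the combinations in which `c.re` and `c.im` enter the
two forms. -/
theorem coef_bounds (hA : IsPerturbed δ β E A) (ha : amin ≤ a ∧ a ≤ amax) {c : ℂ}
    (hc : c = ((a : ℂ) * A.det)⁻¹) :
    0 < c.re ∧ ‖c‖ ≤ 1 / (amin * δ ^ d * alphaC δ β d) ∧
    constB δ β d amax ≤ c.re * (δ * (δ - 2 * β)) - |c.im| * (2 * β * (2 + (β - δ))) ∧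
    c.re * (2 * β * (2 + (β - δ))) + |c.im| * ((2 - δ + β) ^ 2 + β ^ 2) ≤ constC δ β d amin := by
  have hδ := h.δ_pos
  have hβ := h.β_pos
  have hα := h.alpha_pos
  have hα1 := h.alpha_lt_one
  have hb : β / δ ≤ β / (δ - β) :=
    div_le_div_of_nonneg_left hβ.le (by linarith [h.β_lt_δ]) (by linarith)
  have ham := h.amin_pos
  have ha0 : 0 < a := ham.trans_le ha.1
  have hδd : 0 < δ ^ d := pow_pos hδ d
  obtain ⟨ξ, h1, h2⟩ := hA.exists_det_eq h hb
  set d0 := (1 + E).det with hd0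
  have hd0l : δ ^ d ≤ d0 := hA.le_det_real hδ
  have hd0u : d0 ≤ (2 - δ) ^ d := hA.det_real_le hδ
  have hd0p : 0 < d0 := hδd.trans_le hd0l
  set α := alphaC δ β d with hαdef
  have hre : |ξ.re - 1| ≤ 1 - α := by
    have := (Complex.abs_re_le_norm (ξ - 1)).trans h2
    simpa using this
  have him : |ξ.im| ≤ 1 - α := by
    have := (Complex.abs_im_le_norm (ξ - 1)).trans h2
    simpa using this
  have hre1 : α ≤ ξ.re := by linarith [(abs_le.mp hre).1]
  have hre2 : ξ.re ≤ 2 - α := by linarith [(abs_le.mp hre).2]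
  set n := Complex.normSq ξ with hn
  have hn1 : α ^ 2 ≤ n := by
    rw [hn, Complex.normSq_apply]
    nlinarith [mul_self_nonneg ξ.im]
  have hn2 : n ≤ (2 - α) ^ 2 := by
    rw [hn, ← Complex.sq_norm]
    have := norm_sub_norm_le ξ 1
    rw [norm_one] at this
    have h3 : ‖ξ‖ ≤ 2 - α := by linarith
    gcongr
  have hnp : 0 < n := (pow_pos hα 2).trans_le hn1
  have hcr : c.re = ξ.re / (a * d0 * n) := by
    rw [hc, h1, ← mul_assoc, ← Complex.ofReal_mul, Complex.inv_re, Complex.normSq_mul,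
      Complex.normSq_ofReal, Complex.re_ofReal_mul, ← hn]
    field_simp
  have hci : |c.im| = |ξ.im| / (a * d0 * n) := by
    have : c.im = -ξ.im / (a * d0 * n) := by
      rw [hc, h1, ← mul_assoc, ← Complex.ofReal_mul, Complex.inv_im, Complex.normSq_mul,
        Complex.normSq_ofReal, Complex.im_ofReal_mul, ← hn]
      field_simp
    rw [this, abs_div, abs_neg, abs_of_pos (show 0 < a * d0 * n by positivity)]
  have hq : 0 ≤ 2 * β * (2 + (β - δ)) :=
    mul_nonneg (by linarith) (by linarith [h.δ_lt_one])
  have hk : 0 < δ - 2 * β := by linarith [h.four_mul_lt]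
  have h2δ : 0 < 2 - δ := by linarith [h.δ_lt_one]
  refine ⟨?_, ?_, ?_, ?_⟩
  · rw [hcr]
    exact div_pos (hα.trans_le hre1) (by positivity)
  · rw [hc, norm_inv, norm_mul, Complex.norm_real, Real.norm_of_nonneg ha0.le, ← one_div,
      mul_assoc amin]
    have := hA.le_norm_det h hb
    have := ha.1
    gcongr
  -- Expanding the fraction by `d0` produces the squared determinant in the denominator, hence the
  -- exponent `2 * d` of `constB`.
  · have e : c.re * (δ * (δ - 2 * β)) - |c.im| * (2 * β * (2 + (β - δ)))
        = (d0 * ξ.re * (δ * (δ - 2 * β)) - d0 * |ξ.im| * (2 * β * (2 + (β - δ))))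
          / (a * d0 ^ 2 * n) := by
      rw [hcr, hci]
      field_simp
    have h5 : δ ^ (d + 1) * α * (δ - 2 * β) - 2 * β * (2 + (β - δ)) * (1 - α) * (2 - δ) ^ d
        ≤ d0 * ξ.re * (δ * (δ - 2 * β)) - d0 * |ξ.im| * (2 * β * (2 + (β - δ))) := by
      have e1 : δ ^ d * α * (δ * (δ - 2 * β)) ≤ d0 * ξ.re * (δ * (δ - 2 * β)) := by gcongr
      have e2 : d0 * |ξ.im| * (2 * β * (2 + (β - δ)))
          ≤ (2 - δ) ^ d * (1 - α) * (2 * β * (2 + (β - δ))) := by gcongr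
      rw [pow_succ]
      linarith
    rw [e, constB]
    refine div_le_div₀ (h.constB_num_pos.le.trans h5) h5 (by positivity) ?_
    have h6 := ha.2
    have h7 := h.amax_pos
    rw [mul_comm 2 d, pow_mul]
    gcongr
  · have e : c.re * (2 * β * (2 + (β - δ))) + |c.im| * ((2 - δ + β) ^ 2 + β ^ 2)
        = (d0 * ξ.re * (2 * β * (2 + (β - δ))) + d0 * |ξ.im| * ((2 - δ + β) ^ 2 + β ^ 2))
          / (a * d0 ^ 2 * n) := by
      rw [hcr, hci]
      field_simp
    rw [e, constC, one_div_mul_eq_div]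
    have h6 := ha.1
    rw [mul_comm 2 d, pow_mul]
    have : 0 ≤ ξ.re := hα.le.trans hre1
    have h7 : 0 ≤ 2 - α := by linarith
    have h8 : 0 ≤ 1 - α := by linarith
    have h9 : 0 ≤ (2 - δ) ^ d * (2 - α) * (2 * β * (2 + (β - δ)))
        + (2 - δ) ^ d * (1 - α) * ((2 - δ + β) ^ 2 + β ^ 2) := by positivity
    gcongr

theorem re_diffusionMat_lower (hA : IsPerturbed δ β E A) (ha : amin ≤ a ∧ a ≤ amax) (x : Sp d) :
    ‖x‖ ^ 2 ≤ coerConst δ β d amin amax *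
      (x.ofLp ⬝ᵥ ((diffusionMat a A).map Complex.re *ᵥ x.ofLp)) := by
  have hβ := h.β_pos
  have hb : β / δ ≤ β / (δ - β) :=
    div_le_div_of_nonneg_left hβ.le (by linarith [h.β_lt_δ]) (by linarith)
  have ha0 : 0 < a := h.amin_pos.trans_le ha.1
  have hq : 0 ≤ 2 - δ + β := by linarith [h.δ_lt_one]
  set c := ((a : ℂ) * A.det)⁻¹ with hc
  obtain ⟨hc0, hcn, hcB, hcC⟩ := hA.coef_bounds h ha hc
  set G := diffusionMat a A with hG
  have hone := transpose_mul_self_mul_diffusionMat ha0.ne' (hA.det_ne_zero h hb)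
  rw [← hc, ← hG] at hone
  let p : Sp d := WithLp.toLp 2 (G.map Complex.re *ᵥ x.ofLp)
  let q : Sp d := WithLp.toLp 2 (G.map Complex.im *ᵥ x.ofLp)
  have hu : G *ᵥ vecC x = vecC p + Complex.I • vecC q := by
    ext i
    apply Complex.ext
    · simp [mulVec_ofReal_re, p]
    · simp [mulVec_ofReal_im, q]
  -- Here `p + i q = G x`. This is `G⁻¹ (p + i q) = x` tested with a real vector `t`; its real and
  -- imaginary parts, at `t = x, p, q`, are the three relations required by `sq_norm_le_of_forms`.
  have hdot : ∀ t : Sp d, c * ((A *ᵥ vecC t) ⬝ᵥ (A *ᵥ vecC p))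
      + Complex.I * (c * ((A *ᵥ vecC t) ⬝ᵥ (A *ᵥ vecC q))) = ((inner ℝ t x : ℝ) : ℂ) := by
    intro t
    have h1 : (c • (Aᵀ * A)) *ᵥ (G *ᵥ vecC x) = vecC x := by
      rw [Matrix.mulVec_mulVec, hone, Matrix.one_mulVec]
    have h2 : vecC t ⬝ᵥ vecC x = ((inner ℝ t x : ℝ) : ℂ) := by
      simp [dotProduct, PiLp.inner_apply, mul_comm]
    have h3 : ∀ v, vecC t ⬝ᵥ (Aᵀ *ᵥ v) = (A *ᵥ vecC t) ⬝ᵥ v := fun v => by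
      rw [Matrix.dotProduct_mulVec, Matrix.vecMul_transpose]
    rw [← h2, ← h1, hu, Matrix.smul_mulVec, dotProduct_smul, ← Matrix.mulVec_mulVec,
      h3, Matrix.mulVec_add, Matrix.mulVec_smul,
      dotProduct_add, dotProduct_smul, smul_eq_mul, smul_eq_mul]
    ring
  have hre : ∀ t : Sp d, reForm c A t p - imForm c A t q = inner ℝ t x := fun t => by
    have := congrArg Complex.re (hdot t)
    simpa [reForm_apply, imForm, sub_eq_add_neg] using this
  have him : ∀ t : Sp d, imForm c A t p + reForm c A t q = 0 := fun t => by
    have := congrArg Complex.im (hdot t)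
    simpa [reForm_apply, imForm] using this
  have hxp : inner ℝ p x = x.ofLp ⬝ᵥ (G.map Complex.re *ᵥ x.ofLp) := by
    simp [dotProduct, PiLp.inner_apply, p]
  rw [← hxp]
  have hcr := Complex.abs_re_le_norm c
  refine sq_norm_le_of_forms (reForm c A) (imForm c A) (h.constB_pos) (h.normInvBound_pos)
    (reForm_symm c A) ?_ ?_ (imForm_symm c A) ?_ (p := p) (q := q) ?_ (hre p) (him q)
  · intro v
    rw [reForm_apply, dotProduct_mulVec_vecC, Complex.mul_re]
    set r := reApply A v
    set s := imApply A v
    have h1 := hA.le_norm_reApply v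
    have h2 := hA.norm_reApply_le v
    have h3 := hA.norm_imApply_le v
    have hv := norm_nonneg v
    have h4 : |inner ℝ r s| ≤ (2 - δ + β) * β * ‖v‖ ^ 2 := by
      refine (abs_real_inner_le_norm r s).trans ?_
      calc ‖r‖ * ‖s‖ ≤ ((2 - δ + β) * ‖v‖) * (β * ‖v‖) := by gcongr
        _ = _ := by ring
    rw [real_inner_comm r s, real_inner_self_eq_norm_sq, real_inner_self_eq_norm_sq]
    -- The constant is `(δ - β)² - β²`.
    have h5 : δ * (δ - 2 * β) * ‖v‖ ^ 2 ≤ ‖r‖ ^ 2 - ‖s‖ ^ 2 := by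
      have h6 : ((δ - β) * ‖v‖) ^ 2 ≤ ‖r‖ ^ 2 := by
        have : 0 ≤ (δ - β) * ‖v‖ := mul_nonneg (by linarith [h.β_lt_δ]) hv
        gcongr
      have h7 : ‖s‖ ^ 2 ≤ (β * ‖v‖) ^ 2 := by gcongr
      linarith
    have h8 : c.im * (inner ℝ r s + inner ℝ r s)
        ≤ |c.im| * (2 * β * (2 + (β - δ)) * ‖v‖ ^ 2) := by
      refine (le_abs_self _).trans ?_
      rw [abs_mul]
      refine mul_le_mul_of_nonneg_left ?_ (abs_nonneg _)
      rw [← two_mul, abs_mul, abs_two]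
      linarith
    have h9 := mul_le_mul_of_nonneg_left h5 hc0.le
    have h10 := mul_le_mul_of_nonneg_right hcB (sq_nonneg ‖v‖)
    linarith
  · intro v
    rw [reForm_apply]
    refine (Complex.re_le_norm _).trans ?_
    rw [norm_mul]
    -- For `z = r + i s` one has `|zᵀ z|² = (‖r‖² - ‖s‖²)² + 4 ⟨r, s⟩²`, at most `(‖r‖² + ‖s‖²)²` by
    -- Cauchy–Schwarz.
    have h1 : ‖(A *ᵥ vecC v) ⬝ᵥ (A *ᵥ vecC v)‖ ≤ (2 - δ + β) ^ 2 * ‖v‖ ^ 2 := by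
      refine le_trans ?_ (hA.sq_norm_reApply_add_le v)
      rw [dotProduct_mulVec_vecC]
      refine le_of_sq_le_sq ?_ (by positivity)
      rw [Complex.sq_norm, Complex.normSq_apply]
      simp only [real_inner_self_eq_norm_sq, real_inner_comm (reApply A v) (imApply A v)]
      have h2 : inner ℝ (reApply A v) (imApply A v) ^ 2
          ≤ (‖reApply A v‖ * ‖imApply A v‖) ^ 2 := by
        rw [← sq_abs]
        gcongr
        exact abs_real_inner_le_norm _ _
      linarith
    have hpos : 0 ≤ 1 / (amin * δ ^ d * alphaC δ β d) := (norm_nonneg _).trans hcn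
    calc ‖c‖ * ‖(A *ᵥ vecC v) ⬝ᵥ (A *ᵥ vecC v)‖
        ≤ 1 / (amin * δ ^ d * alphaC δ β d) * ((2 - δ + β) ^ 2 * ‖v‖ ^ 2) := by gcongr
      _ = normInvBound δ β d amin * ‖v‖ ^ 2 := by rw [normInvBound]; ring
  · intro v w
    rw [imForm, dotProduct_mulVec_vecC, Complex.mul_im]
    have bd : ∀ {r s : Sp d} {m k : ℝ}, ‖r‖ ≤ m * ‖v‖ → ‖s‖ ≤ k * ‖w‖ → 0 ≤ m →
        |inner ℝ r s| ≤ m * k * (‖v‖ * ‖w‖) := by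
      intro r s m k hr hs hm
      refine (abs_real_inner_le_norm r s).trans ?_
      calc ‖r‖ * ‖s‖ ≤ (m * ‖v‖) * (k * ‖w‖) := by gcongr
        _ = _ := by ring
    have h1 := bd (hA.norm_reApply_le v) (hA.norm_reApply_le w) hq
    have h2 := bd (hA.norm_imApply_le v) (hA.norm_imApply_le w) hβ.le
    have h3 := bd (hA.norm_reApply_le v) (hA.norm_imApply_le w) hq
    have h4 := bd (hA.norm_imApply_le v) (hA.norm_reApply_le w) hβ.le
    set X := inner ℝ (reApply A v) (reApply A w)
    set Y := inner ℝ (imApply A v) (imApply A w)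
    set Z := inner ℝ (reApply A v) (imApply A w)
    set T := inner ℝ (imApply A v) (reApply A w)
    have hZT : |Z + T| ≤ 2 * β * (2 + (β - δ)) * (‖v‖ * ‖w‖) :=
      (abs_add_le Z T).trans (by linarith)
    have hXY : |X - Y| ≤ ((2 - δ + β) ^ 2 + β ^ 2) * (‖v‖ * ‖w‖) :=
      (abs_sub X Y).trans (by linarith)
    calc |c.re * (Z + T) + c.im * (X - Y)| ≤ |c.re * (Z + T)| + |c.im * (X - Y)| := abs_add_le _ _
      _ = c.re * |Z + T| + |c.im| * |X - Y| := by rw [abs_mul, abs_mul, abs_of_pos hc0]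
      _ ≤ c.re * (2 * β * (2 + (β - δ)) * (‖v‖ * ‖w‖))
          + |c.im| * (((2 - δ + β) ^ 2 + β ^ 2) * (‖v‖ * ‖w‖)) := by gcongr
      _ = (c.re * (2 * β * (2 + (β - δ))) + |c.im| * ((2 - δ + β) ^ 2 + β ^ 2))
          * (‖v‖ * ‖w‖) := by ring
      _ ≤ _ := by gcongr
  · rw [hre x, real_inner_self_eq_norm_sq]

end IsPerturbed

/-- Coercivity of a symmetric matrix on complex vectors, from its real part. -/
theorem sum_norm_sq_le_of_re_lower {G : Matrix (Fin d) (Fin d) ℂ} (hG : Gᵀ = G) {K : ℝ}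
    (hK : ∀ x : Sp d, ‖x‖ ^ 2 ≤ K * (x.ofLp ⬝ᵥ (G.map Complex.re *ᵥ x.ofLp)))
    (u : EuclideanSpace ℂ (Fin d)) :
    ‖u‖ ^ 2 ≤ K * (inner ℂ u (Matrix.toEuclideanCLM (n := Fin d) (𝕜 := ℂ) G u)).re := by
  let p : Sp d := WithLp.toLp 2 fun i => (u i).re
  let q : Sp d := WithLp.toLp 2 fun i => (u i).im
  have hu : u.ofLp = vecC p + Complex.I • vecC q := by
    ext i
    apply Complex.ext <;> simp [p, q]
  have hn : ‖u‖ ^ 2 = ‖p‖ ^ 2 + ‖q‖ ^ 2 := by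
    rw [EuclideanSpace.norm_sq_eq, EuclideanSpace.norm_sq_eq, EuclideanSpace.norm_sq_eq,
      ← Finset.sum_add_distrib]
    refine Finset.sum_congr rfl fun i _ => ?_
    rw [Complex.sq_norm, Complex.normSq_apply]
    simp [p, q, pow_two]
  have hform : (inner ℂ u (Matrix.toEuclideanCLM (n := Fin d) (𝕜 := ℂ) G u)).re
      = p.ofLp ⬝ᵥ (G.map Complex.re *ᵥ p.ofLp) + q.ofLp ⬝ᵥ (G.map Complex.re *ᵥ q.ofLp) := by
    have hsym : ∀ i j, G i j = G j i := fun i j => by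
      conv_lhs => rw [← hG]
      rfl
    -- Because `G` is symmetric (not Hermitian), the cross terms involving `Im G` cancel in the real
    -- part.
    have hs : q.ofLp ⬝ᵥ (G.map Complex.im *ᵥ p.ofLp) = p.ofLp ⬝ᵥ (G.map Complex.im *ᵥ q.ofLp) := by
      rw [Matrix.dotProduct_mulVec, dotProduct_comm, ← Matrix.mulVec_transpose]
      congr 2
      ext i j
      simp [hsym i j]
    have h1 : inner ℂ u (Matrix.toEuclideanCLM (n := Fin d) (𝕜 := ℂ) G u)
        = (vecC p - Complex.I • vecC q) ⬝ᵥ (G *ᵥ vecC p + Complex.I • (G *ᵥ vecC q)) := by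
      rw [← Matrix.mulVec_smul, ← Matrix.mulVec_add, ← hu, PiLp.inner_apply, dotProduct]
      refine Finset.sum_congr rfl fun i _ => ?_
      rw [RCLike.inner_apply, Matrix.ofLp_toEuclideanCLM, mul_comm]
      congr 1
      apply Complex.ext <;> simp [p, q]
    have h2 : ∀ v w : Sp d, (vecC v ⬝ᵥ (G *ᵥ vecC w)).re = v.ofLp ⬝ᵥ (G.map Complex.re *ᵥ w.ofLp) := by
      intro v w
      simp [dotProduct, mulVec_ofReal_re]
    have h3 : ∀ v w : Sp d, (vecC v ⬝ᵥ (G *ᵥ vecC w)).im = v.ofLp ⬝ᵥ (G.map Complex.im *ᵥ w.ofLp) := by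
      intro v w
      simp [dotProduct, mulVec_ofReal_im]
    rw [h1, sub_dotProduct, dotProduct_add, dotProduct_add, smul_dotProduct, smul_dotProduct,
      dotProduct_smul, dotProduct_smul]
    simp only [smul_eq_mul, Complex.sub_re, Complex.add_re, Complex.mul_re, Complex.mul_im,
      Complex.I_re, Complex.I_im, h2, h3, hs]
    ring
  rw [hn, hform, mul_add]
  exact add_le_add (hK p) (hK q)

end FormBounds

/-! ### Holomorphic dependence in `L^∞` -/

section LInfty

variable {V W X : Type*} [NormedAddCommGroup V] [NormedSpace ℂ V] [NormedAddCommGroup W]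
  [NormedSpace ℂ W]

/-- Quantitative first order Taylor estimate for bounded holomorphic maps. -/
theorem norm_sub_sub_fderiv_le {g : V → W} {z₀ z : V} {r M : ℝ}
    (hg : DifferentiableOn ℂ g (Metric.ball z₀ r)) (hM : ∀ z ∈ Metric.ball z₀ r, ‖g z‖ ≤ M)
    (hz : z ∈ Metric.ball z₀ r) :
    ‖g z - g z₀ - fderiv ℂ g z₀ (z - z₀)‖ ≤ 4 * M * (‖z - z₀‖ / r) ^ 2 := by
  have hr : 0 < r := Metric.nonempty_ball.mp ⟨_, hz⟩
  have hz₀ : z₀ ∈ Metric.ball z₀ r := Metric.mem_ball_self hr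
  have hD : ‖fderiv ℂ g z₀‖ ≤ 2 * M / r := by
    refine Complex.norm_fderiv_le_div_of_mapsTo_ball hg (fun w hw => ?_) hr
    rw [mem_closedBall_iff_norm]
    linarith [norm_sub_le (g w) (g z₀), hM w hw, hM z₀ hz₀]
  have hd : DifferentiableAt ℂ g z₀ := hg.differentiableAt (Metric.ball_mem_nhds _ hr)
  -- This is the Schwarz lemma for a map agreeing with its value at the centre to first order. The
  -- radius `4 * M` collects `2 * M` from `g - g z₀` and `2 * M` from the linear part.
  have key := Complex.dist_le_mul_div_pow_of_mapsTo_ball_of_isLittleO (n := 1) (c := z₀) (z := z)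
    (R₁ := r) (R₂ := 4 * M) (f := fun w => g w - fderiv ℂ g z₀ (w - z₀)) ?_ ?_ ?_ hz
  · simp only [sub_self, map_zero, sub_zero, dist_eq_norm] at key
    rwa [sub_right_comm] at key
  · exact hg.sub ((fderiv ℂ g z₀).differentiable.comp
      (differentiable_id.sub_const z₀)).differentiableOn
  · intro w hw
    rw [mem_closedBall_iff_norm]
    have h1 : ‖fderiv ℂ g z₀ (w - z₀)‖ ≤ 2 * M := by
      refine ((fderiv ℂ g z₀).le_opNorm _).trans ?_
      have h2 : ‖w - z₀‖ ≤ r := (mem_ball_iff_norm.mp hw).le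
      calc ‖fderiv ℂ g z₀‖ * ‖w - z₀‖ ≤ 2 * M / r * r := by gcongr; exact (norm_nonneg _).trans hD
        _ = 2 * M := by field_simp
    simp only [sub_self, map_zero, sub_zero]
    rw [sub_right_comm]
    linarith [norm_sub_le (g w - g z₀) (fderiv ℂ g z₀ (w - z₀)), norm_sub_le (g w) (g z₀),
      hM w hw, hM z₀ hz₀]
  · have := hd.hasFDerivAt.isLittleO
    simp only [sub_self, map_zero, sub_zero, pow_one]
    refine (this.norm_right).congr_left fun w => ?_
    abel

open Classical in
/-- The class in `L^∞` of an essentially bounded function, and `0` for other functions. -/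
noncomputable def toLInf [MeasurableSpace X] (μ : Measure X) (g : X → W) : Lp W ∞ μ :=
  if h : MemLp g ∞ μ then h.toLp else 0

omit [NormedSpace ℂ W] in
theorem coeFn_toLInf [MeasurableSpace X] {μ : Measure X} {g : X → W} (h : MemLp g ∞ μ) :
    toLInf μ g =ᵐ[μ] g := by
  rw [toLInf, dif_pos h]
  exact h.coeFn_toLp

omit [NormedSpace ℂ W] in
theorem norm_le_of_ae_bound_top [MeasurableSpace X] {μ : Measure X} {g : Lp W ∞ μ} {M : ℝ}
    (hM : 0 ≤ M) (h : ∀ᵐ x ∂μ, ‖g x‖ ≤ M) : ‖g‖ ≤ M := by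
  rw [Lp.norm_def, eLpNorm_exponent_top]
  refine ENNReal.toReal_le_of_le_ofReal hM (eLpNormEssSup_le_of_ae_bound h)

/-- A family of functions that depends holomorphically on a parameter, pointwise almost everywhere
and with a uniform bound, depends holomorphically on the parameter in `L^∞`. -/
theorem differentiableAt_toLInf [MeasurableSpace X] {μ : Measure X} {N : ℕ}
    {g : (Fin N → ℂ) → X → W} {z₀ : Fin N → ℂ} {r M : ℝ} (hr : 0 < r)
    (hmeas : ∀ z ∈ Metric.ball z₀ r, AEStronglyMeasurable (g z) μ)
    (hdiff : ∀ᵐ x ∂μ, DifferentiableOn ℂ (fun z => g z x) (Metric.ball z₀ r))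
    (hbd : ∀ᵐ x ∂μ, ∀ z ∈ Metric.ball z₀ r, ‖g z x‖ ≤ M) :
    DifferentiableAt ℂ (fun z => toLInf μ (g z)) z₀ := by
  have hz₀ : z₀ ∈ Metric.ball z₀ r := Metric.mem_ball_self hr
  wlog hM : 0 ≤ M generalizing M
  · exact this (M := max M 0) (hbd.mono fun x hx z hz => (hx z hz).trans (le_max_left _ _))
      (le_max_right _ _)
  have hmem : ∀ z ∈ Metric.ball z₀ r, MemLp (g z) ∞ μ := fun z hz =>
    memLp_top_of_bound (hmeas z hz) M (hbd.mono fun x hx => hx z hz)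
  set D : X → (Fin N → ℂ) →L[ℂ] W := fun x => fderiv ℂ (fun z => g z x) z₀ with hD
  have hDbd : ∀ᵐ x ∂μ, ‖D x‖ ≤ 2 * M / r := by
    filter_upwards [hdiff, hbd] with x hx hb
    refine Complex.norm_fderiv_le_div_of_mapsTo_ball hx (fun w hw => ?_) hr
    rw [mem_closedBall_iff_norm]
    linarith [norm_sub_le (g w x) (g z₀ x), hb w hw, hb z₀ hz₀]
  -- In each direction the derivative is an a.e. limit of a sequence of measurable difference
  -- quotients, with real increments small enough to stay in the ball.
  have hDmeas : ∀ v : Fin N → ℂ, AEStronglyMeasurable (fun x => D x v) μ := by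
    intro v
    obtain ⟨t, ht0, ht⟩ : ∃ t : ℝ, 0 < t ∧ ∀ s : ℝ, |s| ≤ t → z₀ + (s : ℂ) • v ∈ Metric.ball z₀ r := by
      refine ⟨r / (2 * (‖v‖ + 1)), by positivity, fun s hs => ?_⟩
      rw [mem_ball_iff_norm, add_sub_cancel_left, norm_smul, Complex.norm_real, Real.norm_eq_abs]
      calc |s| * ‖v‖ ≤ r / (2 * (‖v‖ + 1)) * (‖v‖ + 1) := by gcongr; linarith
        _ = r / 2 := by field_simp
        _ < r := by linarith
    let s : ℕ → ℝ := fun n => t / (n + 1)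
    have hs0 : ∀ n, 0 < s n := fun n => by positivity
    have hst : ∀ n, |s n| ≤ t := fun n => by
      rw [abs_of_pos (hs0 n)]
      exact div_le_self ht0.le (by linarith [(Nat.cast_nonneg n : (0 : ℝ) ≤ n)])
    have hslim : Tendsto s atTop (𝓝 0) := by
      have := tendsto_one_div_add_atTop_nhds_zero_nat (𝕜 := ℝ)
      simpa [s, div_eq_mul_inv] using this.const_mul t
    refine aestronglyMeasurable_of_tendsto_ae atTop
      (f := fun n x => ((s n : ℂ))⁻¹ • (g (z₀ + (s n : ℂ) • v) x - g z₀ x))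
      (fun n => ((hmeas _ (ht _ (hst n))).sub (hmeas _ hz₀)).const_smul _) ?_
    filter_upwards [hdiff] with x hx
    have hd := (hx.differentiableAt (Metric.ball_mem_nhds _ hr)).hasFDerivAt
    have h1 := hd.hasLineDerivAt v
    have h2 := h1.tendsto_slope_zero
    refine h2.comp (tendsto_nhdsWithin_iff.mpr ⟨?_, Eventually.of_forall fun n => ?_⟩)
    · have := (Complex.continuous_ofReal.tendsto 0).comp hslim
      simpa [Function.comp_def] using this
    · simp [(hs0 n).ne']
  have hDmem : ∀ v : Fin N → ℂ, MemLp (fun x => D x v) ∞ μ := fun v =>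
    memLp_top_of_bound (hDmeas v) (2 * M / r * ‖v‖) (hDbd.mono fun x hx =>
      ((D x).le_opNorm v).trans (by gcongr))
  let D' : (Fin N → ℂ) →ₗ[ℂ] Lp W ∞ μ :=
    { toFun := fun v => (hDmem v).toLp
      map_add' := fun v w => by
        rw [← MemLp.toLp_add]
        exact MemLp.toLp_congr _ _ (Eventually.of_forall fun x => by simp)
      map_smul' := fun c v => by
        rw [RingHom.id_apply, ← MemLp.toLp_const_smul]
        exact MemLp.toLp_congr _ _ (Eventually.of_forall fun x => by simp) }
  -- Continuity is automatic, as the parameter space is finite dimensional.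
  refine ⟨LinearMap.toContinuousLinearMap D', ?_⟩
  rw [hasFDerivAt_iff_isLittleO]
  -- The pointwise quadratic remainder has a constant independent of `x`, so it is a remainder in
  -- the `L^∞` norm.
  have hO : (fun z => toLInf μ (g z) - toLInf μ (g z₀) - (LinearMap.toContinuousLinearMap D')
      (z - z₀)) =O[𝓝 z₀] fun z => ‖z - z₀‖ ^ 2 := by
    refine Asymptotics.IsBigO.of_bound (4 * M / r ^ 2) ?_
    filter_upwards [Metric.ball_mem_nhds z₀ hr] with z hz
    have h0 : 0 ≤ 4 * M / r ^ 2 * ‖‖z - z₀‖ ^ 2‖ := by positivity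
    refine norm_le_of_ae_bound_top h0 ?_
    have e3 : (D' (z - z₀) : Lp W ∞ μ) =ᵐ[μ] fun x => D x (z - z₀) := (hDmem _).coeFn_toLp
    filter_upwards [Lp.coeFn_sub (toLInf μ (g z) - toLInf μ (g z₀)) (D' (z - z₀)),
      Lp.coeFn_sub (toLInf μ (g z)) (toLInf μ (g z₀)), coeFn_toLInf (hmem z hz),
      coeFn_toLInf (hmem z₀ hz₀), e3, hdiff, hbd] with x h1 h2 h3 h4 h5 h6 h7
    have : ‖g z x - g z₀ x - D x (z - z₀)‖ ≤ _ := norm_sub_sub_fderiv_le h6 h7 hz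
    rw [LinearMap.coe_toContinuousLinearMap', h1, Pi.sub_apply, h2, Pi.sub_apply, h3, h4, h5]
    refine this.trans_eq ?_
    rw [Real.norm_of_nonneg (by positivity)]
    ring
  refine hO.trans_isLittleO ?_
  have := (Asymptotics.isLittleO_norm_pow_id (E' := Fin N → ℂ) (n := 2) (by norm_num))
  have h2 : Tendsto (fun z => z - z₀) (𝓝 z₀) (𝓝 0) := tendsto_sub_nhds_zero_iff.mpr tendsto_id
  exact this.comp_tendsto h2

end LInfty

/-! ### Sobolev spaces: real linear post-composition and the Poincaré inequality -/

section Sobolev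

variable {d : ℕ} {U : Set (Sp d)}

theorem IsTest.comp_clm {𝕜 𝕜' : Type} [RCLike 𝕜] [RCLike 𝕜'] {φ : Sp d → 𝕜} (hφ : IsTest 𝕜 U φ)
    (τ : 𝕜 →L[ℝ] 𝕜') : IsTest 𝕜' U (fun x => τ (φ x)) where
  smooth := τ.contDiff.comp hφ.smooth
  compact := hφ.compact.comp_left (map_zero τ)
  support := (tsupport_comp_subset (map_zero τ) φ).trans hφ.support

theorem IsTest.partialD_comp_clm {𝕜 𝕜' : Type} [RCLike 𝕜] [RCLike 𝕜'] {φ : Sp d → 𝕜}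
    (hφ : IsTest 𝕜 U φ) (τ : 𝕜 →L[ℝ] 𝕜') (i : Fin d) (x : Sp d) :
    partialD (fun x => τ (φ x)) i x = τ (partialD φ i x) := by
  have h := (hφ.smooth.differentiable (by simp)) x
  have := (τ.hasFDerivAt.comp x h.hasFDerivAt).fderiv
  simp only [partialD]
  rw [show (fun x => τ (φ x)) = τ ∘ φ from rfl, this]
  rfl

/-- The action of a real linear map on the components of a vector. -/
noncomputable def vecMap {𝕜 𝕜' : Type} [RCLike 𝕜] [RCLike 𝕜'] (d : ℕ) (τ : 𝕜 →L[ℝ] 𝕜') :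
    EuclideanSpace 𝕜 (Fin d) →L[ℝ] EuclideanSpace 𝕜' (Fin d) :=
  (PiLp.continuousLinearEquiv 2 ℝ (fun _ : Fin d => 𝕜')).symm.toContinuousLinearMap.comp
    ((ContinuousLinearMap.pi fun i => τ.comp (ContinuousLinearMap.proj i)).comp
      (PiLp.continuousLinearEquiv 2 ℝ (fun _ : Fin d => 𝕜)).toContinuousLinearMap)

@[simp]
theorem vecMap_apply {𝕜 𝕜' : Type} [RCLike 𝕜] [RCLike 𝕜'] (τ : 𝕜 →L[ℝ] 𝕜')
    (v : EuclideanSpace 𝕜 (Fin d)) (i : Fin d) : vecMap d τ v i = τ (v i) := rfl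

/-- A real linear map of the scalars acts on `H¹₀`. -/
theorem exists_h10_map {𝕜 𝕜' : Type} [RCLike 𝕜] [RCLike 𝕜'] (τ : 𝕜 →L[ℝ] 𝕜') (u : H10 𝕜 U) :
    ∃ u' : H10 𝕜' U, h10Val u' =ᵐ[muOn U] (fun x => τ (h10Val u x)) ∧
      h10Grad u' =ᵐ[muOn U] fun x => vecMap d τ (h10Grad u x) := by
  let T : L2Pair 𝕜 U → L2Pair 𝕜' U := fun p =>
    WithLp.toLp 2 (τ.compLp p.fst, (vecMap d τ).compLp p.snd)
  have hT : Continuous T := by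
    refine (WithLp.prod_continuous_toLp 2 _ _).comp (Continuous.prodMk ?_ ?_)
    · exact (τ.compLpL 2 (muOn U)).continuous.comp
        (continuous_fst.comp (WithLp.prod_continuous_ofLp 2 _ _))
    · exact ((vecMap d τ).compLpL 2 (muOn U)).continuous.comp
        (continuous_snd.comp (WithLp.prod_continuous_ofLp 2 _ _))
  have hmaps : Set.MapsTo T (testPairs 𝕜 U) (testPairs 𝕜' U) := by
    rintro p ⟨φ, hφ, h1, h2⟩
    refine ⟨fun x => τ (φ x), hφ.comp_clm τ, ?_, ?_⟩
    · filter_upwards [τ.coeFn_compLp p.fst, h1] with x hx hx1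
      exact hx.trans (by rw [hx1])
    · filter_upwards [(vecMap d τ).coeFn_compLp p.snd, h2] with x hx hx1
      refine hx.trans ?_
      rw [hx1]
      ext i
      rw [vecMap_apply]
      exact (hφ.partialD_comp_clm τ i x).symm
  have hu : T u ∈ closure (testPairs 𝕜' U : Set (L2Pair 𝕜' U)) :=
    map_mem_closure hT u.2 hmaps
  exact ⟨⟨T u, hu⟩, τ.coeFn_compLp _, (vecMap d τ).coeFn_compLp _⟩

theorem h10_ext {𝕜 : Type} [RCLike 𝕜] {u v : H10 𝕜 U} (h1 : h10Val u =ᵐ[muOn U] h10Val v)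
    (h2 : h10Grad u =ᵐ[muOn U] h10Grad v) : u = v := by
  apply Subtype.ext
  apply WithLp.ofLp_injective
  exact Prod.ext (Lp.ext h1) (Lp.ext h2)

theorem sq_norm_Lp_two {𝕜 E X : Type*} [RCLike 𝕜] [NormedAddCommGroup E] [InnerProductSpace 𝕜 E]
    [MeasurableSpace X] {μ : Measure X} (f : Lp E 2 μ) : ‖f‖ ^ 2 = ∫ x, ‖f x‖ ^ 2 ∂μ := by
  rw [← inner_self_eq_norm_sq (𝕜 := 𝕜) f, L2.inner_def, ← integral_re (L2.integrable_inner f f)]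
  simp_rw [inner_self_eq_norm_sq]

/-- Integrating by parts against the coordinate `x_i`, whose derivative is `1` and which is bounded
by `R` on `U`, gives `∫ |φ|² = -2 ∫ x_i Re (conj φ · ∂_i φ)`. Young's inequality absorbs half of the
left side. -/
theorem IsTest.poincare {φ : Sp d → ℂ} (hφ : IsTest ℂ U φ) {R : ℝ} (hR : ∀ x ∈ U, ‖x‖ ≤ R)
    (i : Fin d) :
    ∫ x in U, ‖φ x‖ ^ 2 ≤ 4 * R ^ 2 * ∫ x in U, ‖partialD φ i x‖ ^ 2 := by
  have hd : Differentiable ℝ φ := hφ.smooth.differentiable (by simp)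
  have hcφ : Continuous φ := hφ.smooth.continuous
  have hcD : Continuous (partialD φ i) :=
    (hφ.smooth.continuous_fderiv (by simp)).clm_apply continuous_const
  have hsD : HasCompactSupport (partialD φ i) := hφ.compact.fderiv_apply ℝ _
  have hzero : ∀ x, x ∉ U → φ x = 0 := fun x hx =>
    image_eq_zero_of_notMem_tsupport fun h => hx (hφ.support h)
  have hzeroD : ∀ x, x ∉ U → partialD φ i x = 0 := fun x hx => by
    have h0 : fderiv ℝ φ x = 0 := by
      by_contra hne
      exact hx (hφ.support (support_fderiv_subset ℝ (Function.mem_support.mpr hne)))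
    simp [partialD, h0]
  have hsq : HasCompactSupport fun x => ‖φ x‖ ^ 2 :=
    hφ.compact.comp_left (g := fun z : ℂ => ‖z‖ ^ 2) (by simp)
  have hsqD : HasCompactSupport fun x => ‖partialD φ i x‖ ^ 2 :=
    hsD.comp_left (g := fun z : ℂ => ‖z‖ ^ 2) (by simp)
  have hi1 : Integrable fun x => ‖φ x‖ ^ 2 :=
    (hcφ.norm.pow 2).integrable_of_hasCompactSupport hsq
  have hi2 : Integrable fun x => ‖partialD φ i x‖ ^ 2 :=
    (hcD.norm.pow 2).integrable_of_hasCompactSupport hsqD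
  let π : Sp d →L[ℝ] ℝ := EuclideanSpace.proj i
  have hfd : ∀ x, fderiv ℝ (fun x => ‖φ x‖ ^ 2) x (EuclideanSpace.single i 1)
      = 2 * inner ℝ (φ x) (partialD φ i x) := fun x => by
    rw [((hd x).hasFDerivAt.norm_sq).fderiv]
    simp [partialD, mul_add]
  have hpd : ∀ x, fderiv ℝ π x (EuclideanSpace.single i 1) = 1 := fun x => by
    rw [π.fderiv]
    simp [π]
  have hcI : Continuous fun x => 2 * inner ℝ (φ x) (partialD φ i x) :=
    continuous_const.mul (hcφ.inner hcD)
  have hsI : HasCompactSupport fun x => π x * (2 * inner ℝ (φ x) (partialD φ i x)) := by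
    refine hφ.compact.mono fun x hx => ?_
    rw [Function.mem_support] at hx ⊢
    contrapose! hx
    simp [hx]
  have hiI : Integrable fun x => π x * (2 * inner ℝ (φ x) (partialD φ i x)) :=
    (π.continuous.mul hcI).integrable_of_hasCompactSupport hsI
  have hparts : ∫ x, π x * (2 * inner ℝ (φ x) (partialD φ i x)) = - ∫ x, ‖φ x‖ ^ 2 := by
    have := integral_mul_fderiv_eq_neg_fderiv_mul_of_integrable (μ := (volume : Measure (Sp d)))
      (f := π) (g := fun x => ‖φ x‖ ^ 2) (v := EuclideanSpace.single i 1)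
      (by simpa only [hpd, one_mul] using hi1) (by simpa only [hfd] using hiI)
      ((π.continuous.mul (hcφ.norm.pow 2)).integrable_of_hasCompactSupport hsq.mul_left)
      (fun x _ => π.differentiableAt) (fun x _ => (hd x).norm_sq ℝ)
    simpa only [hfd, hpd, one_mul] using this
  have hle : ∫ x, ‖φ x‖ ^ 2 ≤ ∫ x, (1 / 2 * ‖φ x‖ ^ 2 + 2 * R ^ 2 * ‖partialD φ i x‖ ^ 2) := by
    rw [← neg_neg (∫ x, ‖φ x‖ ^ 2), ← hparts, ← integral_neg]
    refine integral_mono hiI.neg ((hi1.const_mul _).add (hi2.const_mul _)) fun x => ?_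
    by_cases hx : x ∈ U
    · have h1 : |π x| ≤ R := (PiLp.norm_apply_le x i).trans (hR x hx)
      have h2 := abs_real_inner_le_norm (φ x) (partialD φ i x)
      calc -(π x * (2 * inner ℝ (φ x) (partialD φ i x)))
          ≤ |π x * (2 * inner ℝ (φ x) (partialD φ i x))| := neg_le_abs _
        _ = |π x| * (2 * |inner ℝ (φ x) (partialD φ i x)|) := by
          rw [abs_mul, abs_mul, abs_two]
        _ ≤ R * (2 * (‖φ x‖ * ‖partialD φ i x‖)) := by
          gcongr
          exact (abs_nonneg _).trans h1
        _ ≤ 1 / 2 * ‖φ x‖ ^ 2 + 2 * R ^ 2 * ‖partialD φ i x‖ ^ 2 := by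
          nlinarith [sq_nonneg (‖φ x‖ - 2 * R * ‖partialD φ i x‖)]
    · simp [hzero x hx, hzeroD x hx]
  rw [integral_add (hi1.const_mul _) (hi2.const_mul _), integral_const_mul, integral_const_mul]
    at hle
  rw [setIntegral_eq_integral_of_forall_compl_eq_zero (fun x hx => by simp [hzero x hx]),
    setIntegral_eq_integral_of_forall_compl_eq_zero (fun x hx => by simp [hzeroD x hx])]
  linarith

/-- The **Poincaré inequality** on bounded sets. -/
theorem exists_poincare (hd : 0 < d) (hUb : Bornology.IsBounded U) :
    ∃ C : ℝ, 0 ≤ C ∧ ∀ v : H10 ℂ U, ‖h10Val v‖ ≤ C * ‖h10Grad v‖ := by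
  obtain ⟨R, hR0, hR⟩ := hUb.exists_pos_norm_le
  refine ⟨2 * R, by positivity, fun v => ?_⟩
  -- The inequality is a closed condition, so it passes from test functions to their closure.
  have hclosed : IsClosed {p : L2Pair ℂ U | ‖p.fst‖ ≤ 2 * R * ‖p.snd‖} := by
    refine isClosed_le ?_ ?_
    · exact (continuous_fst.comp (WithLp.prod_continuous_ofLp 2 _ _)).norm
    · exact continuous_const.mul (continuous_snd.comp (WithLp.prod_continuous_ofLp 2 _ _)).norm
  refine closure_minimal ?_ hclosed v.2
  rintro p ⟨φ, hφ, h1, h2⟩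
  change ‖p.fst‖ ≤ 2 * R * ‖p.snd‖
  refine le_of_sq_le_sq ?_ (by positivity)
  rw [mul_pow, sq_norm_Lp_two (𝕜 := ℂ), sq_norm_Lp_two (𝕜 := ℂ)]
  have e1 : ∫ x in U, ‖p.fst x‖ ^ 2 = ∫ x in U, ‖φ x‖ ^ 2 :=
    integral_congr_ae (h1.mono fun x hx => by simp only [hx])
  rw [e1]
  refine (hφ.poincare hR ⟨0, hd⟩).trans ?_
  rw [mul_pow, show (2 : ℝ) ^ 2 = 4 by norm_num]
  refine mul_le_mul_of_nonneg_left ?_ (by positivity)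
  refine integral_mono_of_nonneg (Eventually.of_forall fun x => by positivity)
    ((Lp.memLp p.snd).integrable_norm_pow (by norm_num)) ?_
  filter_upwards [h2] with x hx
  rw [hx]
  exact pow_le_pow_left₀ (norm_nonneg _) (PiLp.norm_apply_le (grad φ x) ⟨0, hd⟩) 2

theorem poincareConst_nonneg : 0 ≤ poincareConst U := Real.sInf_nonneg fun _ h => h.1

/-- The infimum defining the Poincaré constant is attained. When the gradient vanishes, any one
admissible constant already forces `v = 0`. -/
theorem norm_h10Val_le (hd : 0 < d) (hUb : Bornology.IsBounded U) (v : H10 ℂ U) :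
    ‖h10Val v‖ ≤ poincareConst U * ‖h10Grad v‖ := by
  obtain ⟨C, hC⟩ := exists_poincare hd hUb
  rcases (norm_nonneg (h10Grad v)).eq_or_lt with h0 | h0
  · have := hC.2 v
    rwa [← h0, mul_zero] at this ⊢
  · rw [← div_le_iff₀ h0]
    refine le_csInf ⟨C, hC⟩ fun c hc => ?_
    rw [div_le_iff₀ h0]
    exact hc.2 v

end Sobolev

/-! ### The operator form of the weak problem -/

section Operators

open scoped Matrix.Norms.L2Operator InnerProductSpace

variable {d : ℕ} {U : Set (Sp d)}

instance (𝕜 : Type) [RCLike 𝕜] : CompleteSpace (H10 𝕜 U) :=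
  inferInstanceAs (CompleteSpace (testPairs 𝕜 U).topologicalClosure)

noncomputable instance : Inner ℂ (H10 ℂ U) := InnerProductSpace.toInner

/-- The inclusion of `H¹₀` in `L²` as a continuous linear map. -/
noncomputable def valCLM (U : Set (Sp d)) : H10 ℂ U →L[ℂ] Lp ℂ 2 (muOn U) :=
  (ContinuousLinearMap.fst ℂ _ _).comp
    ((WithLp.prodContinuousLinearEquiv 2 ℂ _ _).toContinuousLinearMap.comp (H10 ℂ U).subtypeL)

/-- The gradient on `H¹₀` as a continuous linear map. -/
noncomputable def gradCLM (U : Set (Sp d)) :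
    H10 ℂ U →L[ℂ] Lp (EuclideanSpace ℂ (Fin d)) 2 (muOn U) :=
  (ContinuousLinearMap.snd ℂ _ _).comp
    ((WithLp.prodContinuousLinearEquiv 2 ℂ _ _).toContinuousLinearMap.comp (H10 ℂ U).subtypeL)

theorem sq_norm_h10 (u : H10 ℂ U) : ‖u‖ ^ 2 = ‖h10Val u‖ ^ 2 + ‖h10Grad u‖ ^ 2 :=
  WithLp.prod_norm_sq_eq_of_L2 _

/-- The action of matrices on vectors as a continuous bilinear map. -/
noncomputable def matAct (d : ℕ) : Matrix (Fin d) (Fin d) ℂ →L[ℂ]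
    EuclideanSpace ℂ (Fin d) →L[ℂ] EuclideanSpace ℂ (Fin d) :=
  LinearMap.toContinuousLinearMap
    ((Matrix.toEuclideanCLM (n := Fin d) (𝕜 := ℂ)).toAlgEquiv.toLinearMap)

/-- Multiplication by an essentially bounded matrix field on square integrable vector fields. -/
noncomputable def mulOp (U : Set (Sp d)) : Lp (Matrix (Fin d) (Fin d) ℂ) ∞ (muOn U) →L[ℂ]
    Lp (EuclideanSpace ℂ (Fin d)) 2 (muOn U) →L[ℂ] Lp (EuclideanSpace ℂ (Fin d)) 2 (muOn U) :=
  (matAct d).holderL (muOn U) ∞ 2 2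

theorem coeFn_mulOp (a : Lp (Matrix (Fin d) (Fin d) ℂ) ∞ (muOn U))
    (g : Lp (EuclideanSpace ℂ (Fin d)) 2 (muOn U)) :
    mulOp U a g =ᵐ[muOn U] fun x => WithLp.toLp 2 (a x *ᵥ (g x).ofLp) :=
  (matAct d).coeFn_holder a g

/-- The operator `u ↦ -div (a ∇u)` on `H¹₀`, by way of the Riesz isomorphism. -/
noncomputable def divOp (a : Lp (Matrix (Fin d) (Fin d) ℂ) ∞ (muOn U)) : H10 ℂ U →L[ℂ] H10 ℂ U :=
  (gradCLM U).adjoint ∘L (mulOp U a) ∘L (gradCLM U)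

/-- The right hand side of the weak problem as an element of `H¹₀`. -/
noncomputable def rhsVec (a : Lp (Matrix (Fin d) (Fin d) ℂ) ∞ (muOn U)) (h : Lp ℂ 2 (muOn U))
    (g : Lp (EuclideanSpace ℂ (Fin d)) 2 (muOn U)) : H10 ℂ U :=
  (valCLM U).adjoint h - (gradCLM U).adjoint (mulOp U a g)

theorem inner_divOp (a : Lp (Matrix (Fin d) (Fin d) ℂ) ∞ (muOn U)) (v u : H10 ℂ U) :
    ⟪v, divOp a u⟫_ℂ = ⟪h10Grad v, mulOp U a (h10Grad u)⟫_ℂ := by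
  simp only [divOp, ContinuousLinearMap.comp_apply]
  rw [ContinuousLinearMap.adjoint_inner_right]
  rfl

theorem inner_rhsVec (a : Lp (Matrix (Fin d) (Fin d) ℂ) ∞ (muOn U)) (h : Lp ℂ 2 (muOn U))
    (g : Lp (EuclideanSpace ℂ (Fin d)) 2 (muOn U)) (v : H10 ℂ U) :
    ⟪v, rhsVec a h g⟫_ℂ = ⟪h10Val v, h⟫_ℂ - ⟪h10Grad v, mulOp U a g⟫_ℂ := by
  rw [rhsVec, inner_sub_right, ContinuousLinearMap.adjoint_inner_right,
    ContinuousLinearMap.adjoint_inner_right]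
  rfl

/-- `v'` is the complex conjugate of `v`. -/
def IsConjPair (v v' : H10 ℂ U) : Prop :=
  h10Val v' =ᵐ[muOn U] (fun x => star (h10Val v x)) ∧
    h10Grad v' =ᵐ[muOn U] fun x => WithLp.toLp 2 (star (h10Grad v x).ofLp)

theorem exists_isConjPair (v : H10 ℂ U) : ∃ v', IsConjPair v v' := by
  obtain ⟨v', h1, h2⟩ := exists_h10_map (Complex.conjCLE : ℂ →L[ℝ] ℂ) v
  exact ⟨v', h1, h2⟩

theorem IsConjPair.symm {v v' : H10 ℂ U} (h : IsConjPair v v') : IsConjPair v' v := by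
  constructor
  · filter_upwards [h.1] with x hx
    rw [hx, star_star]
  · filter_upwards [h.2] with x hx
    rw [hx, star_star]

theorem IsConjPair.integral_val {v v' : H10 ℂ U} (hv : IsConjPair v v') {h : Sp d → ℂ}
    {hL : Lp ℂ 2 (muOn U)} (hh : hL =ᵐ[muOn U] h) :
    ∫ x in U, h x * h10Val v' x = ⟪h10Val v, hL⟫_ℂ := by
  rw [L2.inner_def]
  refine integral_congr_ae ?_
  filter_upwards [hv.1, hh] with x h1 h2
  rw [h1, ← h2, RCLike.inner_apply]
  rfl

/-- Conjugating the test function turns the bilinear form into the sesquilinear inner product; the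
symmetry of `A` moves it from the test function to the other argument. -/
theorem IsConjPair.integral_grad {v v' : H10 ℂ U} (hv : IsConjPair v v')
    {A : Sp d → Matrix (Fin d) (Fin d) ℂ} {a : Lp (Matrix (Fin d) (Fin d) ℂ) ∞ (muOn U)}
    (ha : a =ᵐ[muOn U] A) (hsymm : ∀ x, (A x)ᵀ = A x) {g : Sp d → Fin d → ℂ}
    {gL : Lp (EuclideanSpace ℂ (Fin d)) 2 (muOn U)}
    (hg : gL =ᵐ[muOn U] fun x => WithLp.toLp 2 (g x)) :
    ∫ x in U, g x ⬝ᵥ (A x *ᵥ (h10Grad v' x).ofLp) = ⟪h10Grad v, mulOp U a gL⟫_ℂ := by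
  rw [L2.inner_def]
  refine integral_congr_ae ?_
  filter_upwards [hv.2, hg, ha, coeFn_mulOp a gL] with x h1 h2 h3 h4
  rw [h1, h4, h2, h3, Matrix.dotProduct_mulVec, ← Matrix.mulVec_transpose, hsymm,
    EuclideanSpace.inner_eq_star_dotProduct]

/-- The weak problem for a symmetric coefficient is an equation for `divOp`. -/
theorem isWeakSolution_iff {A : Sp d → Matrix (Fin d) (Fin d) ℂ}
    {a : Lp (Matrix (Fin d) (Fin d) ℂ) ∞ (muOn U)}
    (ha : a =ᵐ[muOn U] A) (hsymm : ∀ x, (A x)ᵀ = A x) {h : Sp d → ℂ} {hL : Lp ℂ 2 (muOn U)}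
    (hh : hL =ᵐ[muOn U] h) {g : Sp d → Fin d → ℂ}
    {gL : Lp (EuclideanSpace ℂ (Fin d)) 2 (muOn U)}
    (hg : gL =ᵐ[muOn U] fun x => WithLp.toLp 2 (g x)) (u : H10 ℂ U) :
    IsWeakSolution U A h g u ↔ divOp a u = rhsVec a hL gL := by
  -- Conjugation permutes the test space, so testing bilinearly with every `v'` is the same as
  -- taking inner products with every `v`.
  have key : ∀ v v', IsConjPair v v' →
      (∫ x in U, (h10Grad u x).ofLp ⬝ᵥ (A x *ᵥ (h10Grad v' x).ofLp) =
        (∫ x in U, h x * h10Val v' x) - ∫ x in U, g x ⬝ᵥ (A x *ᵥ (h10Grad v' x).ofLp)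
      ↔ ⟪v, divOp a u⟫_ℂ = ⟪v, rhsVec a hL gL⟫_ℂ) := by
    intro v v' hv
    rw [hv.integral_val hh, hv.integral_grad ha hsymm hg,
      hv.integral_grad ha hsymm (g := fun x => (h10Grad u x).ofLp) (gL := h10Grad u)
        (EventuallyEq.refl _ _), inner_divOp, inner_rhsVec]
  constructor
  · intro hu
    refine ext_inner_left ℂ fun v => ?_
    obtain ⟨v', hv⟩ := exists_isConjPair v
    exact (key v v' hv).mp (hu v')
  · intro hu v
    obtain ⟨v', hv⟩ := exists_isConjPair v
    exact (key v' v hv.symm).mpr (by rw [hu])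

theorem sq_norm_h10Grad_le {a : Lp (Matrix (Fin d) (Fin d) ℂ) ∞ (muOn U)} {K : ℝ}
    (ha : ∀ᵐ x ∂(muOn U), ∀ v : EuclideanSpace ℂ (Fin d),
      ‖v‖ ^ 2 ≤ K * (⟪v, Matrix.toEuclideanCLM (n := Fin d) (𝕜 := ℂ) (a x) v⟫_ℂ).re)
    (u : H10 ℂ U) : ‖h10Grad u‖ ^ 2 ≤ K * (⟪u, divOp a u⟫_ℂ).re := by
  rw [inner_divOp, L2.inner_def, sq_norm_Lp_two (𝕜 := ℂ)]
  have hint := L2.integrable_inner (𝕜 := ℂ) (h10Grad u) (mulOp U a (h10Grad u))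
  have hre : (∫ x in U, ⟪h10Grad u x, mulOp U a (h10Grad u) x⟫_ℂ).re
      = ∫ x in U, (⟪h10Grad u x, mulOp U a (h10Grad u) x⟫_ℂ).re := (integral_re hint).symm
  rw [hre, ← integral_const_mul]
  refine integral_mono_ae ((Lp.memLp (h10Grad u)).integrable_norm_pow (by norm_num))
    (hint.re.const_mul K) ?_
  filter_upwards [ha, coeFn_mulOp a (h10Grad u)] with x h1 h2
  have h3 := h1 (h10Grad u x)
  change ‖h10Grad u x‖ ^ 2 ≤ K * (⟪h10Grad u x, mulOp U a (h10Grad u) x⟫_ℂ).re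
  rw [h2]
  exact h3

/-- This is Lax–Milgram: `‖u‖² ≤ (CP² + 1) ‖∇u‖² ≤ (CP² + 1) K |⟨divOp a u, u⟩|`. -/
theorem isUnit_divOp (hd : 0 < d) (hUb : Bornology.IsBounded U)
    {a : Lp (Matrix (Fin d) (Fin d) ℂ) ∞ (muOn U)} {K : ℝ} (hK : 0 < K)
    (ha : ∀ᵐ x ∂(muOn U), ∀ v : EuclideanSpace ℂ (Fin d),
      ‖v‖ ^ 2 ≤ K * (⟪v, Matrix.toEuclideanCLM (n := Fin d) (𝕜 := ℂ) (a x) v⟫_ℂ).re) :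
    IsUnit (divOp a) := by
  set CP := poincareConst U
  have hc : 0 < ((CP ^ 2 + 1) * K)⁻¹ := by positivity
  refine ContinuousLinearMap.isUnit_of_forall_le_norm_inner_map _ (c := ⟨_, hc.le⟩) hc fun u => ?_
  have h1 := sq_norm_h10Grad_le ha u
  have h2 : ‖u‖ ^ 2 ≤ (CP ^ 2 + 1) * ‖h10Grad u‖ ^ 2 := by
    have := pow_le_pow_left₀ (norm_nonneg _) (norm_h10Val_le hd hUb u) 2
    rw [sq_norm_h10]
    linarith
  have h3 : (⟪u, divOp a u⟫_ℂ).re ≤ ‖⟪divOp a u, u⟫_ℂ‖ :=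
    (Complex.re_le_norm _).trans_eq (norm_inner_symm _ _)
  change ‖u‖ ^ 2 * ((CP ^ 2 + 1) * K)⁻¹ ≤ _
  rw [← div_eq_mul_inv, div_le_iff₀ (by positivity)]
  calc ‖u‖ ^ 2 ≤ (CP ^ 2 + 1) * ‖h10Grad u‖ ^ 2 := h2
    _ ≤ (CP ^ 2 + 1) * (K * ‖⟪divOp a u, u⟫_ℂ‖) := by
      gcongr
      exact h1.trans (by gcongr)
    _ = _ := by ring

theorem norm_mulOp_le {a : Lp (Matrix (Fin d) (Fin d) ℂ) ∞ (muOn U)} {M : ℝ}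
    (ha : ∀ᵐ x ∂(muOn U), ‖a x‖ ≤ M) (g : Lp (EuclideanSpace ℂ (Fin d)) 2 (muOn U)) :
    ‖mulOp U a g‖ ≤ M * ‖g‖ := by
  refine Lp.norm_le_mul_norm_of_ae_le_mul ?_
  filter_upwards [ha, coeFn_mulOp a g] with x h1 h2
  rw [h2]
  refine ((Matrix.toEuclideanCLM (n := Fin d) (𝕜 := ℂ) (a x)).le_opNorm (g x)).trans ?_
  gcongr
  exact h1

/-- The energy estimate. -/
theorem norm_h10Grad_le (hd : 0 < d) (hUb : Bornology.IsBounded U)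
    {a : Lp (Matrix (Fin d) (Fin d) ℂ) ∞ (muOn U)} {K M : ℝ} (hK : 0 < K)
    (ha : ∀ᵐ x ∂(muOn U), ∀ v : EuclideanSpace ℂ (Fin d),
      ‖v‖ ^ 2 ≤ K * (⟪v, Matrix.toEuclideanCLM (n := Fin d) (𝕜 := ℂ) (a x) v⟫_ℂ).re)
    (haM : ∀ᵐ x ∂(muOn U), ‖a x‖ ≤ M) {h : Lp ℂ 2 (muOn U)}
    {g : Lp (EuclideanSpace ℂ (Fin d)) 2 (muOn U)} {u : H10 ℂ U}
    (hu : divOp a u = rhsVec a h g) :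
    ‖h10Grad u‖ ≤ K * (M * ‖g‖ + poincareConst U * ‖h‖) := by
  have h1 := sq_norm_h10Grad_le ha u
  rw [hu, inner_rhsVec, Complex.sub_re] at h1
  have h2 : (⟪h10Val u, h⟫_ℂ).re ≤ poincareConst U * ‖h10Grad u‖ * ‖h‖ :=
    (Complex.re_le_norm _).trans ((norm_inner_le_norm _ _).trans
      (by gcongr; exact norm_h10Val_le hd hUb u))
  have h3 : -(⟪h10Grad u, mulOp U a g⟫_ℂ).re ≤ ‖h10Grad u‖ * (M * ‖g‖) := by
    refine (neg_le_abs _).trans ((Complex.abs_re_le_norm _).trans ((norm_inner_le_norm _ _).trans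
      (by gcongr; exact norm_mulOp_le haM g)))
  have h4 : ‖h10Grad u‖ * ‖h10Grad u‖
      ≤ ‖h10Grad u‖ * (K * (M * ‖g‖ + poincareConst U * ‖h‖)) := by
    rw [← pow_two]
    refine h1.trans ?_
    calc K * ((⟪h10Val u, h⟫_ℂ).re - (⟪h10Grad u, mulOp U a g⟫_ℂ).re)
        ≤ K * (poincareConst U * ‖h10Grad u‖ * ‖h‖ + ‖h10Grad u‖ * (M * ‖g‖)) := by
          gcongr
          linarith
      _ = _ := by ring
  rcases (norm_nonneg (h10Grad u)).eq_or_lt with h0 | h0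
  · rw [← h0]
    have : 0 ≤ M * ‖g‖ := (norm_nonneg _).trans (norm_mulOp_le haM g)
    have := poincareConst_nonneg (U := U)
    positivity
  · exact le_of_mul_le_mul_left h4 h0

/-- The solution of the weak problem. -/
noncomputable def solVec (a : Lp (Matrix (Fin d) (Fin d) ℂ) ∞ (muOn U)) (h : Lp ℂ 2 (muOn U))
    (g : Lp (EuclideanSpace ℂ (Fin d)) 2 (muOn U)) : H10 ℂ U :=
  Ring.inverse (divOp a) (rhsVec a h g)

theorem divOp_eq_iff {a : Lp (Matrix (Fin d) (Fin d) ℂ) ∞ (muOn U)} (ha : IsUnit (divOp a))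
    (h : Lp ℂ 2 (muOn U)) (g : Lp (EuclideanSpace ℂ (Fin d)) 2 (muOn U)) (u : H10 ℂ U) :
    divOp a u = rhsVec a h g ↔ u = solVec a h g := by
  have h1 : ∀ v, Ring.inverse (divOp a) (divOp a v) = v := fun v => by
    change (Ring.inverse (divOp a) * divOp a) v = v
    rw [Ring.inverse_mul_cancel _ ha]
    rfl
  have h2 : ∀ v, divOp a (Ring.inverse (divOp a) v) = v := fun v => by
    change (divOp a * Ring.inverse (divOp a)) v = v
    rw [Ring.mul_inverse_cancel _ ha]
    rfl
  constructor
  · intro e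
    rw [solVec, ← e, h1]
  · rintro rfl
    rw [solVec, h2]

/-- Units form an open set on which inversion is holomorphic, so invertibility at the single point
`z` suffices. -/
theorem eventually_differentiableAt_inverse_apply {V H : Type*} [NormedAddCommGroup V]
    [NormedSpace ℂ V] [NormedAddCommGroup H] [NormedSpace ℂ H] [CompleteSpace H]
    {T : V → H →L[ℂ] H} {R : V → H} {z : V} (hu : IsUnit (T z))
    (hT : ∀ᶠ z' in 𝓝 z, DifferentiableAt ℂ T z') (hR : ∀ᶠ z' in 𝓝 z, DifferentiableAt ℂ R z') :
    ∀ᶠ z' in 𝓝 z, DifferentiableAt ℂ (fun z => Ring.inverse (T z) (R z)) z' := by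
  have hunit : ∀ᶠ z' in 𝓝 z, IsUnit (T z') :=
    hT.self_of_nhds.continuousAt.eventually (Units.nhds hu.unit)
  filter_upwards [hunit, hT, hR] with z' h1 h2 h3
  exact ((differentiableAt_inverse h1).comp z' h2).clm_apply h3

theorem eventually_differentiableAt_solVec {V : Type*} [NormedAddCommGroup V] [NormedSpace ℂ V]
    {a : V → Lp (Matrix (Fin d) (Fin d) ℂ) ∞ (muOn U)} {h : V → Lp ℂ 2 (muOn U)}
    (g : Lp (EuclideanSpace ℂ (Fin d)) 2 (muOn U)) {z : V} (ha : IsUnit (divOp (a z)))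
    (had : ∀ᶠ z' in 𝓝 z, DifferentiableAt ℂ a z') (hhd : ∀ᶠ z' in 𝓝 z, DifferentiableAt ℂ h z') :
    ∀ᶠ z' in 𝓝 z, DifferentiableAt ℂ (fun z => solVec (a z) (h z) g) z' := by
  have hM : ∀ z', DifferentiableAt ℂ a z' → DifferentiableAt ℂ (fun z => mulOp U (a z)) z' :=
    fun z' hz => (mulOp U).differentiableAt.comp z' hz
  refine eventually_differentiableAt_inverse_apply ha ?_ ?_
  · filter_upwards [had] with z' h2
    exact (differentiableAt_const _).clm_comp ((hM z' h2).clm_comp (differentiableAt_const _))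
  · filter_upwards [had, hhd] with z' h2 h3
    exact ((valCLM U).adjoint.differentiableAt.comp z' h3).sub
      ((gradCLM U).adjoint.differentiableAt.comp z' ((hM z' h2).clm_apply
        (differentiableAt_const g)))

end Operators

/-! ### Real and complex weak solutions -/

section RealComplex

open scoped Matrix.Norms.L2Operator

variable {d : ℕ} {U : Set (Sp d)}

/-- Integrability is what allows real and imaginary parts to be taken under the integral below. -/
theorem integrable_dotProduct_mulVec {A : Sp d → Matrix (Fin d) (Fin d) ℂ}
    (hA : MemLp A ∞ (muOn U)) {g : Sp d → Fin d → ℂ}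
    (hg : MemLp (fun x => (WithLp.toLp 2 (g x) : EuclideanSpace ℂ (Fin d))) 2 (muOn U))
    (k : Lp (EuclideanSpace ℂ (Fin d)) 2 (muOn U)) :
    Integrable (fun x => g x ⬝ᵥ (A x *ᵥ (k x).ofLp)) (muOn U) := by
  have h1 : MemLp (fun x => matAct d (A x) (k x)) 2 (muOn U) :=
    (matAct d).memLp_of_bilin 2 hA (Lp.memLp k)
  refine integrable_finsetSum _ fun i _ => ?_
  have h2 := (EuclideanSpace.proj (𝕜 := ℂ) i).comp_memLp' h1
  have h3 := (EuclideanSpace.proj (𝕜 := ℂ) i).comp_memLp' hg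
  exact h3.integrable_mul h2

variable {A : Sp d → Matrix (Fin d) (Fin d) ℝ} {A' : Sp d → Matrix (Fin d) (Fin d) ℂ}
  {h : Sp d → ℝ} {h' : Sp d → ℂ} {g : Sp d → Sp d}

theorem toC_mulVec_re (M : Matrix (Fin d) (Fin d) ℝ) (v : Fin d → ℂ) (i : Fin d) :
    ((toC M *ᵥ v) i).re = (M *ᵥ fun j => (v j).re) i := by
  simp [Matrix.mulVec, dotProduct]

theorem toC_mulVec_im (M : Matrix (Fin d) (Fin d) ℝ) (v : Fin d → ℂ) (i : Fin d) :
    ((toC M *ᵥ v) i).im = (M *ᵥ fun j => (v j).im) i := by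
  simp [Matrix.mulVec, dotProduct]

theorem ofReal_dotProduct_re (v : Fin d → ℝ) (w : Fin d → ℂ) :
    ((fun i => (v i : ℂ)) ⬝ᵥ w).re = v ⬝ᵥ fun i => (w i).re := by
  simp [dotProduct]

theorem ofReal_dotProduct_im (v : Fin d → ℝ) (w : Fin d → ℂ) :
    ((fun i => (v i : ℂ)) ⬝ᵥ w).im = v ⬝ᵥ fun i => (w i).im := by
  simp [dotProduct]

variable (hA : ∀ᵐ x ∂(muOn U), A' x = toC (A x)) (hA' : MemLp A' ∞ (muOn U))
  (hh : ∀ᵐ x ∂(muOn U), h' x = h x) (hh' : MemLp h' 2 (muOn U)) (hg : MemLp g 2 (muOn U))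

include hg in
theorem memLp_vecC : MemLp (fun x => (WithLp.toLp 2 (vecC (g x)) : EuclideanSpace ℂ (Fin d))) 2
    (muOn U) :=
  (vecMap d Complex.ofRealCLM).comp_memLp' hg

include hA hA' hh hh' hg

/-- A real weak solution is a complex weak solution. -/
theorem IsWeakSolution.ofReal {u : H10 ℝ U} {u' : H10 ℂ U}
    (hu' : h10Grad u' =ᵐ[muOn U] fun x => vecMap d Complex.ofRealCLM (h10Grad u x))
    (hu : IsWeakSolution U A h (fun x => (g x).ofLp) u) :
    IsWeakSolution U A' h' (fun x => vecC (g x)) u' := by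
  intro v
  -- As the coefficients are real, the complex equation tested with `v` is the pair of real
  -- equations tested with `Re v` and `Im v`.
  obtain ⟨v1, hv1, hv1'⟩ := exists_h10_map Complex.reCLM v
  obtain ⟨v2, hv2, hv2'⟩ := exists_h10_map Complex.imCLM v
  have i1 := integrable_dotProduct_mulVec hA' (g := fun x => (h10Grad u' x).ofLp)
    (Lp.memLp (h10Grad u')) (h10Grad v)
  have i2 := integrable_dotProduct_mulVec hA' (memLp_vecC hg) (h10Grad v)
  have i3 : Integrable (fun x => h' x * h10Val v x) (muOn U) :=
    hh'.integrable_mul (Lp.memLp (h10Val v))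
  have r1 : (∫ x in U, (h10Grad u' x).ofLp ⬝ᵥ (A' x *ᵥ (h10Grad v x).ofLp)).re
      = ∫ x in U, (h10Grad u x).ofLp ⬝ᵥ (A x *ᵥ (h10Grad v1 x).ofLp) := by
    refine (integral_re i1).symm.trans (integral_congr_ae ?_)
    filter_upwards [hA, hu', hv1'] with x e1 e2 e3
    rw [e1, e2, e3]
    refine (ofReal_dotProduct_re _ _).trans ?_
    simp_rw [toC_mulVec_re]
    rfl
  have m1 : (∫ x in U, (h10Grad u' x).ofLp ⬝ᵥ (A' x *ᵥ (h10Grad v x).ofLp)).im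
      = ∫ x in U, (h10Grad u x).ofLp ⬝ᵥ (A x *ᵥ (h10Grad v2 x).ofLp) := by
    refine (integral_im i1).symm.trans (integral_congr_ae ?_)
    filter_upwards [hA, hu', hv2'] with x e1 e2 e3
    rw [e1, e2, e3]
    refine (ofReal_dotProduct_im _ _).trans ?_
    simp_rw [toC_mulVec_im]
    rfl
  have r2 : (∫ x in U, vecC (g x) ⬝ᵥ (A' x *ᵥ (h10Grad v x).ofLp)).re
      = ∫ x in U, (g x).ofLp ⬝ᵥ (A x *ᵥ (h10Grad v1 x).ofLp) := by
    refine (integral_re i2).symm.trans (integral_congr_ae ?_)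
    filter_upwards [hA, hv1'] with x e1 e3
    rw [e1, e3]
    refine (ofReal_dotProduct_re _ _).trans ?_
    simp_rw [toC_mulVec_re]
    rfl
  have m2 : (∫ x in U, vecC (g x) ⬝ᵥ (A' x *ᵥ (h10Grad v x).ofLp)).im
      = ∫ x in U, (g x).ofLp ⬝ᵥ (A x *ᵥ (h10Grad v2 x).ofLp) := by
    refine (integral_im i2).symm.trans (integral_congr_ae ?_)
    filter_upwards [hA, hv2'] with x e1 e3
    rw [e1, e3]
    refine (ofReal_dotProduct_im _ _).trans ?_
    simp_rw [toC_mulVec_im]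
    rfl
  have r3 : (∫ x in U, h' x * h10Val v x).re = ∫ x in U, h x * h10Val v1 x := by
    refine (integral_re i3).symm.trans (integral_congr_ae ?_)
    filter_upwards [hh, hv1] with x e1 e3
    rw [e1, e3]
    exact Complex.re_ofReal_mul _ _
  have m3 : (∫ x in U, h' x * h10Val v x).im = ∫ x in U, h x * h10Val v2 x := by
    refine (integral_im i3).symm.trans (integral_congr_ae ?_)
    filter_upwards [hh, hv2] with x e1 e3
    rw [e1, e3]
    exact Complex.im_ofReal_mul _ _
  apply Complex.ext
  · rw [Complex.sub_re, r1, r2, r3]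
    exact hu v1
  · rw [Complex.sub_im, m1, m2, m3]
    exact hu v2

/-- The real part of a complex weak solution of a real problem is a real weak solution. -/
theorem IsWeakSolution.re {u : H10 ℝ U} {u' : H10 ℂ U}
    (hu' : h10Grad u =ᵐ[muOn U] fun x => vecMap d Complex.reCLM (h10Grad u' x))
    (hu : IsWeakSolution U A' h' (fun x => vecC (g x)) u') :
    IsWeakSolution U A h (fun x => (g x).ofLp) u := by
  intro v
  obtain ⟨v', hv, hv'⟩ := exists_h10_map Complex.ofRealCLM v
  have i1 := integrable_dotProduct_mulVec hA' (g := fun x => (h10Grad u' x).ofLp)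
    (Lp.memLp (h10Grad u')) (h10Grad v')
  have i2 := integrable_dotProduct_mulVec hA' (memLp_vecC hg) (h10Grad v')
  have i3 : Integrable (fun x => h' x * h10Val v' x) (muOn U) :=
    hh'.integrable_mul (Lp.memLp (h10Val v'))
  have r1 : (∫ x in U, (h10Grad u' x).ofLp ⬝ᵥ (A' x *ᵥ (h10Grad v' x).ofLp)).re
      = ∫ x in U, (h10Grad u x).ofLp ⬝ᵥ (A x *ᵥ (h10Grad v x).ofLp) := by
    refine (integral_re i1).symm.trans (integral_congr_ae ?_)
    filter_upwards [hA, hu', hv'] with x e1 e2 e3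
    rw [e1, e2, e3]
    have e4 : toC (A x) *ᵥ (vecMap d Complex.ofRealCLM (h10Grad v x)).ofLp
        = fun i => (((A x *ᵥ (h10Grad v x).ofLp) i : ℝ) : ℂ) := by
      ext i
      apply Complex.ext
      · rw [toC_mulVec_re]; simp [Matrix.mulVec, dotProduct]
      · rw [toC_mulVec_im]; simp [Matrix.mulVec, dotProduct]
    rw [e4, dotProduct_comm, dotProduct_comm (vecMap d Complex.reCLM (h10Grad u' x)).ofLp]
    exact ofReal_dotProduct_re _ _
  have r2 : (∫ x in U, vecC (g x) ⬝ᵥ (A' x *ᵥ (h10Grad v' x).ofLp)).re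
      = ∫ x in U, (g x).ofLp ⬝ᵥ (A x *ᵥ (h10Grad v x).ofLp) := by
    refine (integral_re i2).symm.trans (integral_congr_ae ?_)
    filter_upwards [hA, hv'] with x e1 e3
    rw [e1, e3]
    refine (ofReal_dotProduct_re _ _).trans ?_
    simp_rw [toC_mulVec_re]
    rfl
  have r3 : (∫ x in U, h' x * h10Val v' x).re = ∫ x in U, h x * h10Val v x := by
    refine (integral_re i3).symm.trans (integral_congr_ae ?_)
    filter_upwards [hh, hv] with x e1 e3
    rw [e1, e3]
    exact Complex.re_ofReal_mul _ _
  have := congrArg Complex.re (hu v')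
  rwa [Complex.sub_re, r1, r2, r3] at this

end RealComplex

/-! ### Holomorphy and measurability of the coefficients -/

section Coefficients

open scoped Matrix.Norms.L2Operator

variable {d N : ℕ}

theorem differentiable_det : Differentiable ℂ fun A : Matrix (Fin d) (Fin d) ℂ => A.det := by
  have hentry : ∀ i j, Differentiable ℂ fun A : Matrix (Fin d) (Fin d) ℂ => A i j := fun i j =>
    (LinearMap.toContinuousLinearMap (Matrix.entryLinearMap ℂ ℂ i j)).differentiable
  simp_rw [Matrix.det_apply]
  refine Differentiable.fun_sum fun σ _ => ?_
  have h1 : Differentiable ℂ fun A : Matrix (Fin d) (Fin d) ℂ => ∏ i, A (σ i) i :=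
    fun A => (HasFDerivAt.finsetProd fun i _ => (hentry (σ i) i A).hasFDerivAt).differentiableAt
  exact h1.const_smul _

theorem differentiableAt_diffusionMat (a : ℝ) {A : Matrix (Fin d) (Fin d) ℂ} (hA : A.det ≠ 0) :
    DifferentiableAt ℂ (fun A => diffusionMat a A) A := by
  have hu : IsUnit A := (Matrix.isUnit_iff_isUnit_det A).mpr (isUnit_iff_ne_zero.mpr hA)
  have hinv : DifferentiableAt ℂ (fun A : Matrix (Fin d) (Fin d) ℂ => A⁻¹) A := by
    have := differentiableAt_inverse (𝕜 := ℂ) hu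
    exact this.congr_of_eventuallyEq
      (Eventually.of_forall fun B => Matrix.nonsing_inv_eq_ringInverse B)
  have hT : Differentiable ℂ fun B : Matrix (Fin d) (Fin d) ℂ => Bᵀ :=
    (LinearMap.toContinuousLinearMap
      (Matrix.transposeLinearEquiv (Fin d) (Fin d) ℂ ℂ).toLinearMap).differentiable
  exact ((differentiable_det A).const_mul (a : ℂ)).smul (hinv.mul ((hT _).comp A hinv))

theorem aestronglyMeasurable_diffusionMat {X : Type*} [MeasurableSpace X] {μ : Measure X}
    {a : X → ℝ} {A : X → Matrix (Fin d) (Fin d) ℂ} (ha : AEStronglyMeasurable a μ)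
    (hA : AEStronglyMeasurable A μ) : AEStronglyMeasurable (fun x => diffusionMat (a x) (A x)) μ := by
  have hdet : AEStronglyMeasurable (fun x => (A x).det) μ :=
    (Continuous.matrix_det continuous_id).comp_aestronglyMeasurable hA
  have hinv : AEStronglyMeasurable (fun x => (A x)⁻¹) μ := by
    -- The inverse is not continuous on all matrices; adjugate over determinant is measurable all
    -- the same.
    simp_rw [Matrix.inv_def, Ring.inverse_eq_inv']
    exact hdet.aemeasurable.inv.aestronglyMeasurable.smul
      ((Continuous.matrix_adjugate continuous_id).comp_aestronglyMeasurable hA)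
  have hT : AEStronglyMeasurable (fun x => ((A x)⁻¹)ᵀ) μ :=
    (Continuous.matrix_transpose continuous_id).comp_aestronglyMeasurable hinv
  exact ((Complex.continuous_ofReal.comp_aestronglyMeasurable ha).mul hdet).smul (hinv.mul hT)

/-! ### The Jacobian and the mapping: bounds, measurability, dependence on the parameter -/

namespace MapData

variable {U : Set (Sp d)} (P : MapData d N)

/-- The real perturbation `∑ l, √μ_l y_l B_l` of the identity in `∂F(x, y)`. -/
noncomputable def pert (y : Fin N → ℝ) (x : Sp d) : Matrix (Fin d) (Fin d) ℝ :=
  ∑ l, (√(P.mu l) * y l) • P.B l x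

theorem dFC_ofReal (y : Fin N → ℝ) (x : Sp d) : P.dFC (fun l => (y l : ℂ)) x = toC (P.dF y x) := by
  ext i j
  by_cases h : i = j <;> simp [dFC, dF, Matrix.sum_apply, h]

theorem FC_ofReal (y : Fin N → ℝ) (x : Sp d) :
    P.FC (fun l => (y l : ℂ)) x = fun i => ((P.F y x i : ℝ) : ℂ) := by
  ext i
  simp [FC, F]

theorem dFC_sub_toC (z : Fin N → ℂ) (y : Fin N → ℝ) (x : Sp d) :
    P.dFC z x - toC (1 + P.pert y x)
      = ∑ l, ((√(P.mu l) : ℂ) * (z l - y l)) • toC (P.B l x) := by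
  ext i j
  by_cases h : i = j
  · subst h
    simp [dFC, pert, Matrix.sum_apply, mul_sub, sub_mul, Finset.sum_sub_distrib]
  · simp [dFC, pert, Matrix.sum_apply, mul_sub, sub_mul, Finset.sum_sub_distrib, h]

theorem norm_pert_le {δ : ℝ} {x : Sp d} (hB : ∑ l, specNorm (P.B l x) * √(P.mu l) ≤ 1 - δ)
    {y : Fin N → ℝ} (hy : ∀ l, y l ∈ Set.Icc (-1 : ℝ) 1) : ‖P.pert y x‖ ≤ 1 - δ := by
  refine (norm_sum_le _ _).trans (le_trans (Finset.sum_le_sum fun l _ => ?_) hB)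
  rw [norm_smul, norm_mul, Real.norm_of_nonneg (Real.sqrt_nonneg _), mul_comm]
  have h1 : ‖y l‖ ≤ 1 := abs_le.mpr (hy l)
  -- The spectral norm is by definition the operator norm used on matrices here.
  change specNorm (P.B l x) * _ ≤ _
  have : 0 ≤ specNorm (P.B l x) := norm_nonneg _
  gcongr
  exact mul_le_of_le_one_right (Real.sqrt_nonneg _) h1

theorem ofReal_mem_Theta {β : ℝ} {y : Fin N → ℝ} (hy : ∀ l, y l ∈ Set.Icc (-1 : ℝ) 1) :
    (fun l => (y l : ℂ)) ∈ P.Theta U β :=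
  ⟨y, 0, hy, fun l => by simp, by simp⟩

/-- Near a point of `Θ_β`, the matrix `∂F` is a small perturbation of a real one. -/
theorem ae_isPerturbed {δ β : ℝ} (hδ0 : 0 < δ) (hβ0 : 0 ≤ β)
    (hB : ∀ᵐ x ∂(muOn U), ∑ l, specNorm (P.B l x) * √(P.mu l) ≤ 1 - δ)
    {z : Fin N → ℂ} (hz : z ∈ P.Theta U β) :
    ∃ y : Fin N → ℝ, ∀ᵐ x ∂(muOn U), ∀ z' : Fin N → ℂ,
      IsPerturbed δ (β + ‖z' - z‖) (P.pert y x) (P.dFC z' x) := by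
  obtain ⟨y, w, hy, hzw, hsum⟩ := hz
  refine ⟨y, ?_⟩
  have hess : ∀ᵐ x ∂(muOn U), ∀ l, ENNReal.ofReal (specNorm (P.B l x))
      ≤ essSup (fun x => ENNReal.ofReal (specNorm (P.B l x))) (muOn U) :=
    ae_all_iff.mpr fun l => ENNReal.ae_le_essSup _
  filter_upwards [hB, hess] with x hx hx2 z'
  refine ⟨P.norm_pert_le hx hy, ?_⟩
  have h1 : ∑ l, specNorm (P.B l x) * (√(P.mu l) * ‖w l‖) ≤ β := by
    have hs : ∀ l, 0 ≤ specNorm (P.B l x) := fun l => norm_nonneg _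
    rw [← ENNReal.ofReal_le_ofReal_iff hβ0, ENNReal.ofReal_sum_of_nonneg
      (fun l _ => mul_nonneg (hs l) (by positivity))]
    refine le_trans (Finset.sum_le_sum fun l _ => ?_) hsum
    rw [ENNReal.ofReal_mul (hs l)]
    gcongr
    exact hx2 l
  -- The parameter norm is the sup norm, so moving from `z` to `z'` perturbs `∂F` by at most `(1 -
  -- δ) ‖z' - z‖`.
  have h2 : ∑ l, specNorm (P.B l x) * (√(P.mu l) * ‖z' - z‖) ≤ ‖z' - z‖ := by
    simp_rw [← mul_assoc]
    rw [← Finset.sum_mul]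
    exact mul_le_of_le_one_left (norm_nonneg _) (by linarith)
  rw [dFC_sub_toC]
  refine (norm_sum_le _ _).trans ?_
  refine le_trans ?_ (add_le_add h1 h2)
  rw [← Finset.sum_add_distrib]
  refine Finset.sum_le_sum fun l _ => ?_
  rw [norm_smul, norm_mul, Complex.norm_real, Real.norm_of_nonneg (Real.sqrt_nonneg _), mul_comm,
    ← mul_add, ← mul_add]
  have h3 : ‖z' l - y l‖ ≤ ‖w l‖ + ‖z' - z‖ := by
    have : z' l - y l = w l + (z' - z) l := by rw [Pi.sub_apply, hzw l]; ring
    rw [this]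
    exact (norm_add_le _ _).trans (by gcongr; exact norm_le_pi_norm (z' - z) l)
  have h4 : ‖toC (P.B l x)‖ ≤ specNorm (P.B l x) := norm_toC_le _
  have h5 : 0 ≤ specNorm (P.B l x) := norm_nonneg _
  gcongr

theorem aestronglyMeasurable_B (hUo : IsOpen U) (hb : ∀ l, MemW1 ∞ U (P.b l) (P.gradb l))
    (hv : ContDiffOn ℝ 1 P.vhat U) (l : Fin N) :
    AEStronglyMeasurable (fun x => P.B l x) (muOn U) := by
  have hjac : AEStronglyMeasurable (fun x => jac P.vhat x) (muOn U) := by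
    have h1 := hv.continuousOn_fderiv_of_isOpen hUo le_rfl
    have h2 : Continuous fun L : Sp d →L[ℝ] Sp d =>
        (Matrix.of fun i j => L (EuclideanSpace.single j 1) i : Matrix (Fin d) (Fin d) ℝ) :=
      continuous_matrix fun i j => by
        simp only [Matrix.of_apply]
        fun_prop
    exact (h2.comp_continuousOn h1).aestronglyMeasurable hUo.measurableSet
  have hvec : AEStronglyMeasurable
      (fun x => Matrix.vecMulVec (P.vhat x).ofLp (P.gradb l x).ofLp) (muOn U) := by
    have h1 : AEStronglyMeasurable P.vhat (muOn U) :=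
      hv.continuousOn.aestronglyMeasurable hUo.measurableSet
    have h2 : Continuous fun p : Sp d × Sp d => Matrix.vecMulVec p.1.ofLp p.2.ofLp :=
      continuous_matrix fun i j => by
        simp only [Matrix.vecMulVec_apply]
        fun_prop
    exact h2.comp_aestronglyMeasurable (h1.prodMk (hb l).memLp_grad.1)
  exact ((hb l).memLp.1.smul hjac).add hvec

theorem aestronglyMeasurable_dFC (hUo : IsOpen U) (hb : ∀ l, MemW1 ∞ U (P.b l) (P.gradb l))
    (hv : ContDiffOn ℝ 1 P.vhat U) (z : Fin N → ℂ) :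
    AEStronglyMeasurable (fun x => P.dFC z x) (muOn U) := by
  have hC : Continuous fun M : Matrix (Fin d) (Fin d) ℝ => toC M :=
    continuous_matrix fun i j => by
      simp only [Matrix.map_apply]
      exact Complex.continuous_ofReal.comp (continuous_id.matrix_elem i j)
  refine aestronglyMeasurable_const.add (Finset.aestronglyMeasurable_fun_sum _ fun l _ => ?_)
  exact (hC.comp_aestronglyMeasurable (P.aestronglyMeasurable_B hUo hb hv l)).const_smul
    ((√(P.mu l) : ℂ) * z l)

theorem aestronglyMeasurable_FC (hUo : IsOpen U) (hb : ∀ l, MemW1 ∞ U (P.b l) (P.gradb l))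
    (hv : ContDiffOn ℝ 1 P.vhat U) (z : Fin N → ℂ) :
    AEStronglyMeasurable (fun x => P.FC z x) (muOn U) := by
  have h1 : AEStronglyMeasurable P.vhat (muOn U) :=
    hv.continuousOn.aestronglyMeasurable hUo.measurableSet
  have hcoord : ∀ i, Continuous fun x : Sp d => ((x i : ℝ) : ℂ) := fun i =>
    Complex.continuous_ofReal.comp (by fun_prop)
  refine (aemeasurable_pi_lambda _ fun i => ?_).aestronglyMeasurable
  refine AEStronglyMeasurable.aemeasurable ?_
  refine (hcoord i).aestronglyMeasurable.add (AEStronglyMeasurable.mul ?_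
    ((hcoord i).comp_aestronglyMeasurable h1))
  refine Finset.aestronglyMeasurable_fun_sum _ fun l _ => AEStronglyMeasurable.mul ?_
    aestronglyMeasurable_const
  exact Complex.continuous_ofReal.comp_aestronglyMeasurable
    (aestronglyMeasurable_const.mul (hb l).memLp.1)

theorem differentiable_dFC (x : Sp d) : Differentiable ℂ fun z : Fin N → ℂ => P.dFC z x := by
  unfold dFC
  refine (differentiable_const _).add (Differentiable.fun_sum fun l _ => ?_)
  exact (((differentiable_apply l).const_mul _)).smul_const _

theorem differentiable_FC (x : Sp d) : Differentiable ℂ fun z : Fin N → ℂ => P.FC z x := by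
  unfold FC
  refine differentiable_pi.mpr fun i => ?_
  refine (differentiable_const _).add ((Differentiable.fun_sum fun l _ => ?_).mul_const _)
  exact (differentiable_apply l).const_mul _

/-- The mapping is bounded on `U`, locally uniformly in the complex parameter. -/
theorem exists_norm_FC_le (hUb : Bornology.IsBounded U)
    (hF : ∀ y : Fin N → ℝ, (∀ l, y l ∈ Set.Icc (-1 : ℝ) 1) → Bornology.IsBounded (P.F y '' U))
    (R : ℝ) : ∃ M : ℝ, ∀ x ∈ U, ∀ z : Fin N → ℂ, ‖z‖ ≤ R → ‖P.FC z x‖ ≤ M := by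
  obtain ⟨R₀, hR₀, hU⟩ := hUb.exists_pos_norm_le
  have hl : ∀ l, ∃ C : ℝ, ∀ x ∈ U, ‖(√(P.mu l) * P.b l x) • P.vhat x‖ ≤ C := by
    intro l
    -- The field `v̂` is only `C¹` on the open set and may be unbounded. The product `b_l v̂` is
    -- bounded up to `√μ_l`, because the image of `F` at the `l`-th unit vector is.
    obtain ⟨C, hC⟩ := (hF (Pi.single l 1) (fun k => by
      by_cases h : k = l
      · subst h; simp
      · simp [h])).exists_norm_le
    refine ⟨C + R₀, fun x hx => ?_⟩
    have h1 : P.F (Pi.single l 1) x = x + (√(P.mu l) * P.b l x) • P.vhat x := by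
      simp [F, Pi.single_apply]
    have h2 := hC _ (Set.mem_image_of_mem _ hx)
    rw [h1] at h2
    calc ‖(√(P.mu l) * P.b l x) • P.vhat x‖
        = ‖(x + (√(P.mu l) * P.b l x) • P.vhat x) - x‖ := by rw [add_sub_cancel_left]
      _ ≤ C + R₀ := (norm_sub_le _ _).trans (add_le_add h2 (hU x hx))
  choose C hC using hl
  refine ⟨R₀ + ∑ l, C l * R, fun x hx z hz => ?_⟩
  have hC0 : ∀ l, 0 ≤ C l := fun l => (norm_nonneg _).trans (hC l x hx)
  have hR : 0 ≤ R := (norm_nonneg _).trans hz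
  refine (pi_norm_le_iff_of_nonneg
    (add_nonneg hR₀.le (Finset.sum_nonneg fun l _ => mul_nonneg (hC0 l) hR))).mpr fun i => ?_
  refine (norm_add_le _ _).trans (add_le_add ?_ ?_)
  · rw [Complex.norm_real]
    exact (PiLp.norm_apply_le x i).trans (hU x hx)
  · rw [Finset.sum_mul]
    refine (norm_sum_le _ _).trans (Finset.sum_le_sum fun l _ => ?_)
    rw [mul_right_comm, norm_mul, ← Complex.ofReal_mul, Complex.norm_real]
    refine mul_le_mul ?_ ((norm_le_pi_norm z l).trans hz) (norm_nonneg _) (hC0 l)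
    exact (PiLp.norm_apply_le ((√(P.mu l) * P.b l x) • P.vhat x) i).trans (hC l x hx)

end MapData

end Coefficients

/-! ### The main theorem -/

section Main

open scoped Matrix.Norms.L2Operator

variable {d N : ℕ}

theorem IsPerturbed.mono {δ b b' : ℝ} {E : Matrix (Fin d) (Fin d) ℝ}
    {A : Matrix (Fin d) (Fin d) ℂ} (h : IsPerturbed δ b E A) (hb : b ≤ b') :
    IsPerturbed δ b' E A :=
  ⟨h.norm_real, h.norm_sub.trans hb⟩

namespace AdmissibleConsts

variable {δ β amin amax : ℝ} (h : AdmissibleConsts d δ β amin amax)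

include h

/-- The bounds for the determinant hold for perturbations slightly larger than `β`. -/
theorem exists_radius : ∃ r : ℝ, 0 < r ∧ (β + r) / δ ≤ β / (δ - β) ∧ β + r < δ := by
  have h1 : 0 < δ - β := by linarith [h.β_lt_δ]
  have h2 := h.four_mul_lt
  have hβ := h.β_pos
  have hδ := h.δ_pos
  -- The largest radius allowed by the second condition; the third then amounts to `2 * β < δ`.
  refine ⟨δ * β / (δ - β) - β, ?_, le_of_eq ?_, ?_⟩
  · rw [sub_pos, lt_div_iff₀ h1]
    nlinarith
  · field_simp
    ring
  · rw [add_sub_cancel, div_lt_iff₀ h1]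
    nlinarith

theorem div_le : β / δ ≤ β / (δ - β) :=
  div_le_div_of_nonneg_left h.β_pos.le (by linarith [h.β_lt_δ]) (by linarith [h.β_pos])

theorem coerConst_mul_le {s : ℝ} (hs : s ≤ gainC δ β d) :
    coerConst δ β d amin amax * s ≤ (epsC δ β d amax amin)⁻¹ := by
  rw [mul_comm]
  exact (mul_le_mul_of_nonneg_right hs h.coerConst_pos.le).trans h.gainC_mul_coerConst_le

/-- Compared with `constE`, the energy estimate has the extra factors `(δ / (δ - β))²` on the
lifting term and `(2 - δ)^d` on the load term. Both are at most `gainC`, which passing from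
`coerConst` to `1 / ε` absorbs. -/
theorem estimate_le {nf nw CP : ℝ} (hnf : 0 ≤ nf) (hnw : 0 ≤ nw) (hCP : 0 ≤ CP) :
    coerConst δ β d amin amax *
        (amax * ((2 - δ) ^ d * (2 - alphaC δ β d)) * ((δ - β) ^ 2)⁻¹ * nw
          + CP * ((2 - δ) ^ d * (2 - alphaC δ β d) * nf))
      ≤ constE nf nw amax δ (alphaC δ β d) d CP / epsC δ β d amax amin := by
  have h1 := h.coerConst_mul_le h.pow_le_gainC
  have h2 := h.coerConst_mul_le h.sq_div_le_gainC
  have hα : 0 ≤ 2 - alphaC δ β d := by linarith [h.alpha_lt_one]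
  have hδ := h.δ_pos
  have hδβ : 0 < δ - β := by linarith [h.β_lt_δ]
  have ha := h.amax_pos
  have hp : 0 < (2 - δ) ^ d := zero_lt_one.trans_le h.one_le_pow_two_sub
  have e1 : 0 ≤ (2 - alphaC δ β d) * (CP * nf) := by positivity
  have e2 : 0 ≤ (2 - alphaC δ β d) * (nw * amax * (2 - δ) ^ d / δ ^ 2) := by positivity
  calc _ = (2 - alphaC δ β d) * (nw * amax * (2 - δ) ^ d / δ ^ 2)
          * (coerConst δ β d amin amax * (δ / (δ - β)) ^ 2)
        + (2 - alphaC δ β d) * (CP * nf) * (coerConst δ β d amin amax * (2 - δ) ^ d) := by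
        field_simp
    _ ≤ (2 - alphaC δ β d) * (nw * amax * (2 - δ) ^ d / δ ^ 2) * (epsC δ β d amax amin)⁻¹
        + (2 - alphaC δ β d) * (CP * nf) * (epsC δ β d amax amin)⁻¹ :=
      add_le_add (mul_le_mul_of_nonneg_left h2 e2) (mul_le_mul_of_nonneg_left h1 e1)
    _ = _ := by
      rw [constE]
      field_simp

end AdmissibleConsts

/-- Evaluate the form at a unit eigenvector. -/
theorem eigenvalues_ge_of_form_ge {M : Matrix (Fin d) (Fin d) ℝ} (hM : M.IsHermitian) {K ε : ℝ}
    (hε : 0 < ε) (hKε : K ≤ ε⁻¹) (h : ∀ x : Sp d, ‖x‖ ^ 2 ≤ K * (x.ofLp ⬝ᵥ (M *ᵥ x.ofLp)))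
    (hK : 0 < K) (i : Fin d) : ε ≤ hM.eigenvalues i := by
  have h1 := h (hM.eigenvectorBasis i)
  have hn : ‖hM.eigenvectorBasis i‖ = 1 := hM.eigenvectorBasis.orthonormal.1 i
  have hs : (hM.eigenvectorBasis i).ofLp ⬝ᵥ (hM.eigenvectorBasis i).ofLp = 1 := by
    have h2 := real_inner_self_eq_norm_sq (hM.eigenvectorBasis i)
    rw [hn, one_pow, EuclideanSpace.inner_eq_star_dotProduct] at h2
    simpa using h2
  have hmul : M *ᵥ (hM.eigenvectorBasis i).ofLp
      = hM.eigenvalues i • (hM.eigenvectorBasis i).ofLp := hM.mulVec_eigenvectorBasis i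
  rw [hmul, dotProduct_smul, hs, hn, one_pow, smul_eq_mul, mul_one] at h1
  have h2 : 0 < hM.eigenvalues i := pos_of_mul_pos_right (zero_lt_one.trans_le h1) hK.le
  have h3 : 1 ≤ ε⁻¹ * hM.eigenvalues i := h1.trans (by gcongr)
  rwa [inv_mul_eq_div, one_le_div hε] at h3

/-- The inclusion of `L^∞` in `L²` for a finite measure. -/
noncomputable def lInfToL2 {X : Type*} [MeasurableSpace X] (μ : Measure X) [IsFiniteMeasure μ] :
    Lp ℂ ∞ μ →L[ℂ] Lp ℂ 2 μ :=
  ((ContinuousLinearMap.mul ℂ ℂ).holderL μ ∞ 2 2).flip (memLp_const (1 : ℂ)).toLp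

theorem coeFn_lInfToL2 {X : Type*} [MeasurableSpace X] {μ : Measure X} [IsFiniteMeasure μ]
    (f : Lp ℂ ∞ μ) : lInfToL2 μ f =ᵐ[μ] f := by
  have h1 : lInfToL2 μ f =ᵐ[μ] fun x => f x * (memLp_const (p := 2) (μ := μ) (1 : ℂ)).toLp _ x :=
    (ContinuousLinearMap.mul ℂ ℂ).coeFn_holder f _
  filter_upwards [h1, (memLp_const (p := 2) (μ := μ) (1 : ℂ)).coeFn_toLp] with x e1 e2
  rw [e1, e2, mul_one]

theorem norm_vecMap_ofReal (v : Sp d) : ‖vecMap d Complex.ofRealCLM v‖ = ‖v‖ := by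
  rw [EuclideanSpace.norm_eq, EuclideanSpace.norm_eq]
  simp

/-- Each point within `r / 2` of `z₀` is the centre of a ball of radius `r / 2` on which the same
bounds hold. -/
theorem eventually_differentiableAt_toLInf {W X : Type*} [NormedAddCommGroup W] [NormedSpace ℂ W]
    [MeasurableSpace X] {μ : Measure X} {g : (Fin N → ℂ) → X → W} {z₀ : Fin N → ℂ} {r M : ℝ}
    (hr : 0 < r) (hmeas : ∀ z, AEStronglyMeasurable (g z) μ)
    (hdiff : ∀ᵐ x ∂μ, DifferentiableOn ℂ (fun z => g z x) (Metric.ball z₀ r))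
    (hbd : ∀ᵐ x ∂μ, ∀ z ∈ Metric.ball z₀ r, ‖g z x‖ ≤ M) :
    ∀ᶠ z in 𝓝 z₀, DifferentiableAt ℂ (fun z => toLInf μ (g z)) z := by
  filter_upwards [Metric.ball_mem_nhds z₀ (half_pos hr)] with z hz
  have hsub : Metric.ball z (r / 2) ⊆ Metric.ball z₀ r := by
    refine Metric.ball_subset_ball' ?_
    rw [Metric.mem_ball] at hz
    linarith
  exact differentiableAt_toLInf (half_pos hr) (fun z _ => hmeas z)
    (hdiff.mono fun x hx => hx.mono hsub) (hbd.mono fun x hx z hz => hx z (hsub hz))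

end Main

open scoped Matrix.Norms.L2Operator in
theorem mainTheorem2 {d N : ℕ} (hd : 0 < d)
    (U : Set (Sp d)) (hUo : IsOpen U) (hUb : Bornology.IsBounded U)
    (P : MapData d N) (hmu : ∀ l, 0 ≤ P.mu l)
    (hb : ∀ l, MemW1 ∞ U (P.b l) (P.gradb l))
    (hv : ContDiffOn ℝ 1 P.vhat U)
    (hF : ∀ y : Fin N → ℝ, (∀ l, y l ∈ Set.Icc (-1 : ℝ) 1) → Bornology.IsBounded (P.F y '' U))
    (aF : Sp d → ℝ) (haF : AEStronglyMeasurable aF (muOn U))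
    (amin amax : ℝ) (hamin : 0 < amin) (hamax : amin ≤ amax)
    (ha : ∀ᵐ x ∂(muOn U), amin ≤ aF x ∧ aF x ≤ amax)
    (f : Sp d → ℝ) (fC : (Fin d → ℂ) → ℂ) (hfC : Differentiable ℂ fC)
    (hf : ∀ x : Sp d, fC (fun i => (x i : ℂ)) = (f x : ℂ))
    (w : Sp d → ℝ) (gradw : Sp d → Sp d) (hw : MemW1 2 U w gradw)
    (δ : ℝ) (hδ0 : 0 < δ) (hδ1 : δ < 1)
    (hB : ∀ᵐ x ∂(muOn U), ∑ l, specNorm (P.B l x) * √(P.mu l) ≤ 1 - δ)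
    (β : ℝ) (hβ0 : 0 < β)
    (hβ : β < min (δ * Real.log (gammaC δ d) / (d + Real.log (gammaC δ d)))
      (√(1 + δ ^ 2 / 2) - 1)) :
    0 < epsC δ β d amax amin ∧
    (∀ z ∈ P.Theta U β, ∀ᵐ x ∂(muOn U),
      ∃ h : ((P.G aF z x).map Complex.re).IsHermitian,
        ∀ i, epsC δ β d amax amin ≤ h.eigenvalues i) ∧
    ∃ Ψ : (Fin N → ℂ) → H10 ℂ U,
      (∀ z ∈ P.Theta U β, ∀ᶠ z' in 𝓝 z, DifferentiableAt ℂ Ψ z') ∧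
      (∀ y : Fin N → ℝ, (∀ l, y l ∈ Set.Icc (-1 : ℝ) 1) →
        ∃ u : H10 ℝ U, (∀ u', P.IsSolution U aF f gradw y u' ↔ u' = u) ∧
          h10Val (Ψ fun l => (y l : ℂ)) =ᵐ[muOn U] fun x => ((h10Val u x : ℝ) : ℂ)) ∧
      (∀ z ∈ P.Theta U β, ∀ u', P.IsSolutionC U aF fC gradw z u' ↔ u' = Ψ z) ∧
      ∀ z ∈ P.Theta U β,
        MemLp (fun x => fC (P.FC z x)) 2 (muOn U) ∧
        ‖h10Grad (Ψ z)‖ ≤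
          constE (eLpNorm (fun x => fC (P.FC z x)) 2 (muOn U)).toReal
            (eLpNorm gradw 2 (muOn U)).toReal amax δ (alphaC δ β d) d (poincareConst U)
          / epsC δ β d amax amin := by
  have hc : AdmissibleConsts d δ β amin amax :=
    ⟨hd, hδ0, hδ1, hβ0, hβ.trans_le (min_le_left _ _), hβ.trans_le (min_le_right _ _), hamin,
      hamax⟩
  have hfin : IsFiniteMeasure (muOn U) := ⟨by
    rw [Measure.restrict_apply_univ]
    exact hUb.measure_lt_top⟩
  set K := coerConst δ β d amin amax with hKdef
  have hK : 0 < K := hc.coerConst_pos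
  have hpert : ∀ z ∈ P.Theta U β, ∃ y : Fin N → ℝ, ∀ᵐ x ∂(muOn U),
      IsPerturbed δ β (P.pert y x) (P.dFC z x) := fun z hz => by
    obtain ⟨y, hy⟩ := P.ae_isPerturbed hδ0 hβ0.le hB hz
    refine ⟨y, hy.mono fun x hx => ?_⟩
    simpa using hx z
  have hform : ∀ z ∈ P.Theta U β, ∀ᵐ x ∂(muOn U), ∀ v : Sp d,
      ‖v‖ ^ 2 ≤ K * (v.ofLp ⬝ᵥ ((P.G aF z x).map Complex.re *ᵥ v.ofLp)) := fun z hz => by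
    obtain ⟨y, hy⟩ := hpert z hz
    filter_upwards [hy, ha] with x h1 h2 v
    exact h1.re_diffusionMat_lower hc h2 v
  have hGsymm : ∀ z x, (P.G aF z x)ᵀ = P.G aF z x := fun z x => diffusionMat_transpose _ _
  have hGmeas : ∀ z, AEStronglyMeasurable (P.G aF z) (muOn U) := fun z =>
    aestronglyMeasurable_diffusionMat haF (P.aestronglyMeasurable_dFC hUo hb hv z)
  have hGbd : ∀ z ∈ P.Theta U β, ∀ᵐ x ∂(muOn U),
      ‖P.G aF z x‖ ≤ amax * ((2 - δ) ^ d * (2 - alphaC δ β d)) * ((δ - β) ^ 2)⁻¹ := fun z hz => by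
    obtain ⟨y, hy⟩ := hpert z hz
    filter_upwards [hy, ha] with x h1 h2
    exact h1.norm_diffusionMat_le hc hc.div_le hc.β_lt_δ h2
  have hGmem : ∀ z ∈ P.Theta U β, MemLp (P.G aF z) ∞ (muOn U) := fun z hz =>
    memLp_top_of_bound (hGmeas z) _ (hGbd z hz)
  have hcoer : ∀ z ∈ P.Theta U β, ∀ᵐ x ∂(muOn U), ∀ v : EuclideanSpace ℂ (Fin d),
      ‖v‖ ^ 2 ≤ K * (inner ℂ v (Matrix.toEuclideanCLM (n := Fin d) (𝕜 := ℂ)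
        (toLInf (muOn U) (P.G aF z) x) v)).re := fun z hz => by
    filter_upwards [hform z hz, coeFn_toLInf (hGmem z hz)] with x h1 h2 v
    rw [h2]
    exact sum_norm_sq_le_of_re_lower (hGsymm z x) h1 v
  have hunit : ∀ z ∈ P.Theta U β, IsUnit (divOp (toLInf (muOn U) (P.G aF z))) := fun z hz =>
    isUnit_divOp hd hUb hK (hcoer z hz)
  have hFCmeas : ∀ z, AEStronglyMeasurable (fun x => fC (P.FC z x)) (muOn U) := fun z =>
    hfC.continuous.comp_aestronglyMeasurable (P.aestronglyMeasurable_FC hUo hb hv z)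
  -- For bounded `z` the mapping stays in one compact ball, where the entire function `fC` is
  -- bounded.
  have hfbd : ∀ R : ℝ, ∃ M : ℝ, ∀ x ∈ U, ∀ z : Fin N → ℂ, ‖z‖ ≤ R → ‖fC (P.FC z x)‖ ≤ M := by
    intro R
    obtain ⟨M, hM⟩ := P.exists_norm_FC_le hUb hF R
    obtain ⟨M', hM'⟩ := (isCompact_closedBall (0 : Fin d → ℂ) M).exists_bound_of_continuousOn
      hfC.continuous.continuousOn
    exact ⟨M', fun x hx z hz => hM' _ (mem_closedBall_zero_iff.mpr (hM x hx z hz))⟩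
  have hUae : ∀ᵐ x ∂(muOn U), x ∈ U := ae_restrict_mem hUo.measurableSet
  have hFCmem : ∀ z, MemLp (fun x => fC (P.FC z x)) 2 (muOn U) := fun z => by
    obtain ⟨M, hM⟩ := hfbd ‖z‖
    exact MemLp.of_bound (hFCmeas z) M (hUae.mono fun x hx => hM x hx z le_rfl)
  set hfun : (Fin N → ℂ) → Sp d → ℂ := fun z x => fC (P.FC z x) * (P.dFC z x).det with hfundef
  have hdetmeas : ∀ z, AEStronglyMeasurable (fun x => (P.dFC z x).det) (muOn U) := fun z =>
    differentiable_det.continuous.comp_aestronglyMeasurable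
      (P.aestronglyMeasurable_dFC hUo hb hv z)
  have hhmeas : ∀ z, AEStronglyMeasurable (hfun z) (muOn U) := fun z =>
    (hFCmeas z).mul (hdetmeas z)
  obtain ⟨r, hr0, hr1, hr2⟩ := hc.exists_radius
  have hball : ∀ z ∈ P.Theta U β, ∃ y : Fin N → ℝ, ∀ᵐ x ∂(muOn U), ∀ z' ∈ Metric.ball z r,
      IsPerturbed δ (β + r) (P.pert y x) (P.dFC z' x) := fun z hz => by
    obtain ⟨y, hy⟩ := P.ae_isPerturbed hδ0 hβ0.le hB hz
    refine ⟨y, hy.mono fun x hx z' hz' => (hx z').mono ?_⟩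
    have := (mem_ball_iff_norm.mp hz').le
    linarith
  have hhbd : ∀ z ∈ P.Theta U β, ∃ M, ∀ᵐ x ∂(muOn U), ∀ z' ∈ Metric.ball z r,
      ‖hfun z' x‖ ≤ M := fun z hz => by
    obtain ⟨y, hy⟩ := hball z hz
    obtain ⟨M, hM⟩ := hfbd (‖z‖ + r)
    refine ⟨M * ((2 - δ) ^ d * (2 - alphaC δ β d)), ?_⟩
    filter_upwards [hy, hUae] with x h1 h2 z' hz'
    have h3 : ‖z'‖ ≤ ‖z‖ + r := by
      have h4 := (mem_ball_iff_norm.mp hz').le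
      have h5 := norm_sub_norm_le z' z
      linarith
    have h6 := hM x h2 z' h3
    rw [hfundef, norm_mul]
    exact mul_le_mul h6 ((h1 z' hz').norm_det_le hc hr1) (norm_nonneg _)
      ((norm_nonneg _).trans h6)
  have hhmem : ∀ z ∈ P.Theta U β, MemLp (hfun z) ∞ (muOn U) := fun z hz => by
    obtain ⟨M, hM⟩ := hhbd z hz
    exact memLp_top_of_bound (hhmeas z) M (hM.mono fun x hx => hx z (Metric.mem_ball_self hr0))
  -- The load goes through `L^∞`, where holomorphy is proved; the continuous linear inclusion in
  -- `L²` preserves it.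
  set hL : (Fin N → ℂ) → Lp ℂ 2 (muOn U) := fun z => lInfToL2 (muOn U) (toLInf (muOn U) (hfun z))
    with hLdef
  have hLae : ∀ z ∈ P.Theta U β, hL z =ᵐ[muOn U] hfun z := fun z hz =>
    (coeFn_lInfToL2 _).trans (coeFn_toLInf (hhmem z hz))
  have hgmem := memLp_vecC hw.memLp_grad
  set gL : Lp (EuclideanSpace ℂ (Fin d)) 2 (muOn U) := hgmem.toLp with hgLdef
  have hgL : gL =ᵐ[muOn U] fun x => WithLp.toLp 2 (vecC (gradw x)) := hgmem.coeFn_toLp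
  have hgLnorm : ‖gL‖ = (eLpNorm gradw 2 (muOn U)).toReal := by
    rw [hgLdef, Lp.norm_toLp]
    congr 1
    exact eLpNorm_congr_norm_ae (Eventually.of_forall fun x => norm_vecMap_ofReal (gradw x))
  set Ψ : (Fin N → ℂ) → H10 ℂ U := fun z => solVec (toLInf (muOn U) (P.G aF z)) (hL z) gL
    with hΨ
  have hsol : ∀ z ∈ P.Theta U β, ∀ u', P.IsSolutionC U aF fC gradw z u' ↔ u' = Ψ z :=
    fun z hz u' => (isWeakSolution_iff (coeFn_toLInf (hGmem z hz)) (hGsymm z) (hLae z hz) hgL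
      u').trans (divOp_eq_iff (hunit z hz) _ _ _)
  refine ⟨hc.epsC_pos, fun z hz => ?_, Ψ, fun z hz => ?_, fun y hy => ?_, hsol, fun z hz =>
    ⟨hFCmem z, ?_⟩⟩
  · filter_upwards [hform z hz] with x hx
    have hherm : ((P.G aF z x).map Complex.re).IsHermitian := by
      ext i j
      rw [Matrix.conjTranspose_apply, Matrix.map_apply, Matrix.map_apply, star_trivial]
      conv_rhs => rw [← hGsymm z x]
      rfl
    refine ⟨hherm, eigenvalues_ge_of_form_ge hherm hc.epsC_pos ?_ hx hK⟩
    simpa using hc.coerConst_mul_le hc.one_le_gainC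
  · refine eventually_differentiableAt_solVec gL (hunit z hz) ?_ ?_
    · obtain ⟨y, hy⟩ := hball z hz
      refine eventually_differentiableAt_toLInf hr0 hGmeas
        (M := amax * ((2 - δ) ^ d * (2 - alphaC δ β d)) * ((δ - (β + r)) ^ 2)⁻¹) ?_ ?_
      · filter_upwards [hy] with x hx z' hz'
        have hdiff := differentiableAt_diffusionMat (aF x) ((hx z' hz').det_ne_zero hc hr1)
        exact (hdiff.comp z' (P.differentiable_dFC x z')).differentiableWithinAt
      · filter_upwards [hy, ha] with x hx hax z' hz'
        exact (hx z' hz').norm_diffusionMat_le hc hr1 hr2 hax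
    · obtain ⟨M, hM⟩ := hhbd z hz
      have := eventually_differentiableAt_toLInf hr0 hhmeas (Eventually.of_forall fun x =>
        ((hfC.comp (P.differentiable_FC x)).mul
          (differentiable_det.comp (P.differentiable_dFC x))).differentiableOn) hM
      exact this.mono fun z' hz' => (lInfToL2 (muOn U)).differentiableAt.comp z' hz'
  · set z : Fin N → ℂ := fun l => (y l : ℂ) with hzdef
    have hz : z ∈ P.Theta U β := P.ofReal_mem_Theta hy
    have hdet : ∀ᵐ x ∂(muOn U), 0 < (P.dF y x).det := by
      filter_upwards [hB] with x hx
      exact det_one_add_pos hδ0 (P.norm_pert_le hx hy)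
    -- For real parameters the determinant is positive, so `G` is the real coefficient `(a ∘ F) |∂F|
    -- C⁻¹`.
    have hreal : ∀ᵐ x ∂(muOn U),
        P.G aF z x = toC ((aF x * |(P.dF y x).det|) • ((P.dF y x)ᵀ * P.dF y x)⁻¹) := by
      filter_upwards [hdet] with x hx
      have hinv : (toC (P.dF y x))⁻¹ = toC (P.dF y x)⁻¹ := by
        refine Matrix.inv_eq_right_inv ?_
        have h1 : P.dF y x * (P.dF y x)⁻¹ = 1 :=
          Matrix.mul_nonsing_inv _ (isUnit_iff_ne_zero.mpr hx.ne')
        have h2 : toC (P.dF y x) * toC (P.dF y x)⁻¹ = toC (P.dF y x * (P.dF y x)⁻¹) :=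
          (Matrix.map_mul (f := Complex.ofRealHom)).symm
        rw [h2, h1, toC_one]
      rw [MapData.G, P.dFC_ofReal, hinv, det_toC, abs_of_pos hx, Matrix.mul_inv_rev,
        ← Matrix.transpose_nonsing_inv]
      ext i j
      simp [Matrix.mul_apply]
    have hrhs : ∀ᵐ x ∂(muOn U), hfun z x = ((f (P.F y x) * |(P.dF y x).det| : ℝ) : ℂ) := by
      filter_upwards [hdet] with x hx
      rw [hfundef]
      simp only [hzdef]
      rw [P.FC_ofReal, hf, P.dFC_ofReal, det_toC, abs_of_pos hx, Complex.ofReal_mul]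
    have hh2 : MemLp (hfun z) 2 (muOn U) := (hhmem z hz).mono_exponent le_top
    -- The real part of the complex solution gives existence. Complexifying any real solution gives
    -- `Ψ z` by complex uniqueness, hence real uniqueness and the fact that `Ψ z` is real.
    obtain ⟨u, hu1, hu2⟩ := exists_h10_map Complex.reCLM (Ψ z)
    have husol : P.IsSolution U aF f gradw y u :=
      IsWeakSolution.re hreal (hGmem z hz) hrhs hh2 hw.memLp_grad hu2 ((hsol z hz _).mpr rfl)
    have hlift : ∀ u', P.IsSolution U aF f gradw y u' →
        h10Val (Ψ z) =ᵐ[muOn U] (fun x => ((h10Val u' x : ℝ) : ℂ)) ∧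
        h10Grad (Ψ z) =ᵐ[muOn U] fun x => vecMap d Complex.ofRealCLM (h10Grad u' x) := by
      intro u' hu'
      obtain ⟨uc, huc1, huc2⟩ := exists_h10_map Complex.ofRealCLM u'
      have := (hsol z hz uc).mp
        (IsWeakSolution.ofReal hreal (hGmem z hz) hrhs hh2 hw.memLp_grad huc2 hu')
      rw [← this]
      exact ⟨huc1, huc2⟩
    refine ⟨u, fun u' => ⟨fun hu' => ?_, fun e => e ▸ husol⟩, (hlift u husol).1⟩
    obtain ⟨h1, h2⟩ := hlift u' hu'
    refine h10_ext ?_ ?_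
    · filter_upwards [h1, hu1] with x e1 e2
      rw [e2, e1]
      exact (Complex.ofReal_re _).symm
    · filter_upwards [h2, hu2] with x e1 e2
      rw [e2, e1]
      ext i
      exact (Complex.ofReal_re _).symm
  · have hGae : ∀ᵐ x ∂(muOn U), ‖toLInf (muOn U) (P.G aF z) x‖
        ≤ amax * ((2 - δ) ^ d * (2 - alphaC δ β d)) * ((δ - β) ^ 2)⁻¹ := by
      filter_upwards [hGbd z hz, coeFn_toLInf (hGmem z hz)] with x h1 h2
      rwa [h2]
    have h1 := norm_h10Grad_le hd hUb hK (hcoer z hz) hGae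
      ((divOp_eq_iff (hunit z hz) (hL z) gL (Ψ z)).mpr rfl)
    -- The factor in front of the norm of `f ∘ F` is the pointwise bound for `|det ∂F|`.
    have hhn : ‖hL z‖ ≤ (2 - δ) ^ d * (2 - alphaC δ β d)
        * (eLpNorm (fun x => fC (P.FC z x)) 2 (muOn U)).toReal := by
      rw [← Lp.norm_toLp _ (hFCmem z)]
      refine Lp.norm_le_mul_norm_of_ae_le_mul ?_
      obtain ⟨y, hy⟩ := hpert z hz
      filter_upwards [hy, hLae z hz, (hFCmem z).coeFn_toLp] with x e1 e2 e3
      rw [e2, e3, hfundef, norm_mul, mul_comm]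
      gcongr
      exact e1.norm_det_le hc hc.div_le
    rw [hgLnorm] at h1
    refine le_trans (h1.trans ?_) (hc.estimate_le ENNReal.toReal_nonneg ENNReal.toReal_nonneg
      poincareConst_nonneg)
    have := poincareConst_nonneg (U := U)
    gcongr
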